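/- Conventions. Manifolds and maps are smooth. A Lie groupoid $G\rightrightarrows Q$ has source $\alpha$ and target $\beta$ (smooth submersions), identity section $\epsilon$, inversion, and a smooth multiplication $(g,h)\mapsto gh$ defined on $G_2=\{(g,h)\in G\times G:\beta(g)=\alpha(h)\}$. Its Lie algebroid $AG$ has fibre $A_qG=T_{\epsilon(q)}(\alpha^{-1}(q))=\ker T_{\epsilon(q)}\alpha$ at $q\in Q$. For $a\in A_{\beta(g)}G$ let $\overleftarrow{a}(g)=T_{\epsilon(\beta(g))}\ell_g(a)$ with $\ell_g(h)=gh$, and for $a\in A_{\alpha(g)}G$ let $\overrightarrow{a}(g)=-T_{\epsilon(\alpha(g))}(h\mapsto h^{-1}g)(a)$. The source and target maps $\tilde\alpha,\tilde\beta:T^*G\to A^*G$ of the cotangent groupoid are defined for $\mu\in T_g^*G$ by $\tilde\alpha(\mu)\in A^*_{\alpha(g)}G$, $\langle\tilde\alpha(\mu),a\rangle=\langle\mu,\overrightarrow{a}(g)\rangle$, and $\tilde\beta(\mu)\in A^*_{\beta(g)}G$, $\langle\tilde\beta(\mu),a\rangle=\langle\mu,\overleftarrow{a}(g)\rangle$.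 The prolongation of $G$ over $\alpha$ is the Lie groupoid $\mathcal P^\alpha G\rightrightarrows G$, $$\mathcal P^\alpha G=\{(g,h,r)\in G\times G\times G:\ \alpha(g)=\alpha(h),\ \beta(h)=\alpha(r)\},$$ with source $(g,h,r)\mapsto g$, target $(g,h,r)\mapsto r$, multiplication $(g,h,r)(r,h',r')=(g,hh',r')$, identities $g\mapsto(g,\epsilon(\alpha(g)),g)$ and inversion $(g,h,r)\mapsto(r,h^{-1},g)$. We regard $G_2$ as a submanifold of it through $i_{G_2}(g,h)=(g,g,h)$. For a smooth function $L_d:G_2\to\mathbb R$ (a discrete second-order Lagrangian) put $$\Sigma_{L_d}=\{\mu\in T^*(\mathcal P^\alpha G):\ \mu \text{ is a covector at a point of } i_{G_2}(G_2) \text{ and } i_{G_2}^*\mu=dL_d \text{ at that point}\}.$$ A morphism of Lie groupoids $\chi:\Gamma\to\Gamma'$ (over $M$ and $M'$, with source maps $\alpha,\alpha'$) is a smooth map between the manifolds of arrows such that, for every composable pair $(x,y)$, the pair $(\chi(x),\chi(y))$ is composable and $\chi(xy)=\chi(x)\chi(y)$. It induces $\chi_0=\alpha'\circ\chi\circ\epsilon:M\to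 M'$ on objects and $A\chi:A\Gamma\to A\Gamma'$, the differential of $\chi$ along the source fibres at the identities. Covectors $\mu\in T_x^*\Gamma$ and $\mu'\in T_{\chi(x)}^*\Gamma'$ are $\chi^*$-related if $\langle\mu,\xi\rangle=\langle\mu',T_x\chi(\xi)\rangle$ for all $\xi\in T_x\Gamma$. Elements $z\in A_m^*\Gamma$ and $z'\in A^*_{\chi_0(m)}\Gamma'$ are $A^*\chi$-related if $\langle z,\xi\rangle=\langle z',A\chi(\xi)\rangle$ for all $\xi\in A_m\Gamma$. Theorem. Let $G\rightrightarrows Q$ and $G'\rightrightarrows Q'$ be Lie groupoids, let $L_d:G_2\to\mathbb R$ and $L_d':G_2'\to\mathbb R$ be discrete second-order Lagrangians, and let $\chi:\mathcal P^\alpha G\to\mathcal P^{\alpha'}G'$ be a morphism of Lie groupoids such that $G_2=\chi^{-1}(G_2')$ (as subsets of the prolongations) and $L_d=L_d'\circ\chi|_{G_2}$. Let $\mu\in T_x^*(\mathcal P^\alpha G)$ and $\mu'\in T_{\chi(x)}^*(\mathcal P^{\alpha'}G')$ be $\chi^*$-related. Then: 1. if $\mu'\in\Sigma_{L_d'}$,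 then $\mu\in\Sigma_{L_d}$; 2. the sources $\tilde\alpha(\mu)\in A^*(\mathcal P^\alpha G)$ and $\tilde\alpha'(\mu')\in A^*(\mathcal P^{\alpha'}G')$ in the cotangent groupoids of the prolongations are $A^*\chi$-related (in particular, $\tilde\alpha'(\mu')$ lies over the image under $\chi_0$ of the base point of $\tilde\alpha(\mu)$); 3. likewise the targets $\tilde\beta(\mu)$ and $\tilde\beta'(\mu')$ are $A^*\chi$-related. -/

import Mathlib

open Set Filter Topology
open scoped Manifold ContDiff

theorem exists_straightening {E F : Type*} [NormedAddCommGroup E] [NormedSpace ℝ E]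
    [FiniteDimensional ℝ E] [NormedAddCommGroup F] [NormedSpace ℝ F] [FiniteDimensional ℝ F]
    {d : ℕ} (hd : Module.finrank ℝ E - Module.finrank ℝ F = d) {f : E → F} {z₀ : E} {V : Set E}
    (hV : IsOpen V) (hz : z₀ ∈ V) (hf : ContDiffOn ℝ ∞ f V)
    (hs : Function.Surjective (fderiv ℝ f z₀)) :
    ∃ R : OpenPartialHomeomorph E (F × EuclideanSpace ℝ (Fin d)),
      z₀ ∈ R.source ∧ R.source ⊆ V ∧ ContDiffOn ℝ ∞ R R.source ∧
      ContDiffOn ℝ ∞ R.symm R.target ∧ ∀ z ∈ R.source, (R z).1 = f z := by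
  have : CompleteSpace E := FiniteDimensional.complete ℝ E
  have : CompleteSpace F := FiniteDimensional.complete ℝ F
  set D := fderiv ℝ f z₀ with hD
  set K := LinearMap.ker (D : E →ₗ[ℝ] F) with hK
  have hrank : Module.finrank ℝ K = Module.finrank ℝ (EuclideanSpace ℝ (Fin d)) := by
    have h1 := LinearMap.finrank_range_add_finrank_ker (D : E →ₗ[ℝ] F)
    have h2 : LinearMap.range (D : E →ₗ[ℝ] F) = ⊤ := LinearMap.range_eq_top.2 hs
    rw [h2, finrank_top, ← hK] at h1
    rw [finrank_euclideanSpace_fin]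
    omega
  let κ : K ≃L[ℝ] EuclideanSpace ℝ (Fin d) := ContinuousLinearEquiv.ofFinrankEq hrank
  obtain ⟨π, hπ⟩ := LinearMap.exists_leftInverse_of_injective K.subtype K.ker_subtype
  let L : E →L[ℝ] EuclideanSpace ℝ (Fin d) :=
    (κ : K →L[ℝ] EuclideanSpace ℝ (Fin d)).comp (LinearMap.toContinuousLinearMap π)
  have hL : ∀ k : K, L k = κ k := fun k => by
    have := LinearMap.congr_fun hπ k
    simp only [LinearMap.comp_apply, Submodule.subtype_apply, LinearMap.id_apply] at this
    simp [L, this]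
  let Φ : E → F × EuclideanSpace ℝ (Fin d) := fun z => (f z, L z)
  have hΦ : ContDiffOn ℝ ∞ Φ V := hf.prodMk L.contDiff.contDiffOn
  have hfat : ∀ z ∈ V, ContDiffAt ℝ ∞ f z := fun z hz => hf.contDiffAt (hV.mem_nhds hz)
  have hΦat : ∀ z ∈ V, ContDiffAt ℝ ∞ Φ z := fun z hz => hΦ.contDiffAt (hV.mem_nhds hz)
  have hder : HasFDerivAt Φ (D.prod L) z₀ :=
    (((hfat z₀ hz).differentiableAt (by simp)).hasFDerivAt).prodMk L.hasFDerivAt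
  have hinj : Function.Injective (D.prod L) := by
    refine (injective_iff_map_eq_zero _).2 fun v hv => ?_
    have h1 : D v = 0 := congrArg Prod.fst hv
    have h2 : L v = 0 := congrArg Prod.snd hv
    have h3 := hL ⟨v, h1⟩
    have h4 : κ ⟨v, h1⟩ = 0 := by rw [← h3]; exact h2
    have h5 := (map_eq_zero_iff κ κ.injective).1 h4
    exact congrArg Subtype.val h5
  have hsurj : Function.Surjective (D.prod L) := by
    rintro ⟨a, t⟩
    obtain ⟨v, hv⟩ := hs a
    refine ⟨v + (κ.symm (t - L v) : K), ?_⟩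
    have h1 : D (κ.symm (t - L v) : K) = 0 := (κ.symm (t - L v)).2
    ext1
    · change D (v + (κ.symm (t - L v) : K)) = a
      rw [map_add, h1, add_zero]; exact hv
    · change L (v + (κ.symm (t - L v) : K)) = t
      rw [map_add, hL]; simp
  let e : E ≃L[ℝ] F × EuclideanSpace ℝ (Fin d) :=
    ContinuousLinearEquiv.ofBijective (D.prod L) (LinearMap.ker_eq_bot.2 hinj)
      (LinearMap.range_eq_top.2 hsurj)
  have hder' : HasFDerivAt Φ (e : E →L[ℝ] F × EuclideanSpace ℝ (Fin d)) z₀ := by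
    convert hder using 1; exact ContinuousLinearEquiv.coe_ofBijective _ _ _
  let R₀ := (hΦat z₀ hz).toOpenPartialHomeomorph Φ hder' (by simp)
  have hR₀ : z₀ ∈ R₀.source := (hΦat z₀ hz).mem_toOpenPartialHomeomorph_source hder' (by simp)
  have hcont : ContinuousOn (fderiv ℝ Φ) V := hΦ.continuousOn_fderiv_of_isOpen hV (by simp)
  let W : Set E := V ∩ (fderiv ℝ Φ) ⁻¹' range ((↑) : (E ≃L[ℝ] F × EuclideanSpace ℝ (Fin d)) → _)
  have hW : IsOpen W := hcont.isOpen_inter_preimage hV (ContinuousLinearEquiv.isOpen)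
  have hzW : z₀ ∈ W := ⟨hz, e, hder'.fderiv.symm⟩
  refine ⟨R₀.restrOpen W hW, ⟨hR₀, hzW⟩, fun z hz => hz.2.1, fun z hz =>
    (hΦat z hz.2.1).contDiffWithinAt, fun t ht => ?_, fun z _ => rfl⟩
  have ht' := (R₀.restrOpen W hW).map_target ht
  have htW : R₀.symm t ∈ W := ht'.2
  have ht0 : t ∈ R₀.target := by
    have := R₀.map_source ht'.1
    have h2 := (R₀.restrOpen W hW).right_inv ht
    change R₀ (R₀.symm t) = t at h2
    have h3 : R₀ (R₀.symm t) ∈ R₀.target := this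
    rwa [h2] at h3
  obtain ⟨e', he'⟩ := htW.2
  refine (R₀.contDiffAt_symm (f₀' := e') ht0 ?_ (hΦat _ htW.1)).contDiffWithinAt
  rw [he']
  exact ((hΦat _ htW.1).differentiableAt (by simp)).hasFDerivAt

/-- `IsLevelAt I F p x`: near the point `x`, the set `{y | p y}` is the zero set of a smooth map with values in
the vector space `F` whose differential at `x` is surjective. -/
def IsLevelAt {E H M : Type*} [NormedAddCommGroup E] [NormedSpace ℝ E] [TopologicalSpace H]
    (I : ModelWithCorners ℝ E H) [TopologicalSpace M] [ChartedSpace H M]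
    (F : Type*) [NormedAddCommGroup F] [NormedSpace ℝ F] (p : M → Prop) (x : M) : Prop :=
  ∃ (U : Set M) (f : M → F), IsOpen U ∧ x ∈ U ∧ ContMDiffOn I 𝓘(ℝ, F) ∞ f U ∧
    Function.Surjective (mfderiv I 𝓘(ℝ, F) f x) ∧ ∀ y ∈ U, p y ↔ f y = 0

/-- A chart of the subspace `{y // p y}` of `M` is a submanifold chart if its inverse is smooth as a map into `M`
and if it is locally the restriction of smooth maps defined on open subsets of `M`. -/
def IsSubmanifoldChart {E H M : Type*} [NormedAddCommGroup E] [NormedSpace ℝ E]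
    [TopologicalSpace H] (I : ModelWithCorners ℝ E H) [TopologicalSpace M] [ChartedSpace H M]
    (p : M → Prop) {d : ℕ} (ψ : OpenPartialHomeomorph {y // p y} (EuclideanSpace ℝ (Fin d))) :
    Prop :=
  ContMDiffOn (𝓡 d) I ∞ (fun t => (ψ.symm t : M)) ψ.target ∧
  ∀ y ∈ ψ.source, ∃ (U : Set M) (g : M → EuclideanSpace ℝ (Fin d)), IsOpen U ∧ (y : M) ∈ U ∧
    ContMDiffOn I (𝓡 d) ∞ g U ∧ ∀ z ∈ ψ.source, (z : M) ∈ U → ψ z = g z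

section Submanifold

variable {E H M : Type*} [NormedAddCommGroup E] [NormedSpace ℝ E] [FiniteDimensional ℝ E]
  [TopologicalSpace H] {I : ModelWithCorners ℝ E H} [I.Boundaryless]
  [TopologicalSpace M] [ChartedSpace H M] [IsManifold I ∞ M]
  {F : Type*} [NormedAddCommGroup F] [NormedSpace ℝ F] [FiniteDimensional ℝ F]
  {p : M → Prop} {d : ℕ}

theorem exists_manifold_straightening {x : M}
    (hd : Module.finrank ℝ E - Module.finrank ℝ F = d) {U : Set M} {f : M → F}
    (hU : IsOpen U) (hxU : x ∈ U) (hf : ContMDiffOn I 𝓘(ℝ, F) ∞ f U)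
    (hs : Function.Surjective (mfderiv I 𝓘(ℝ, F) f x)) :
    ∃ Θ : OpenPartialHomeomorph M (F × EuclideanSpace ℝ (Fin d)),
      x ∈ Θ.source ∧ Θ.source ⊆ U ∧
      ContMDiffOn I 𝓘(ℝ, F × EuclideanSpace ℝ (Fin d)) ∞ Θ Θ.source ∧
      ContMDiffOn 𝓘(ℝ, F × EuclideanSpace ℝ (Fin d)) I ∞ Θ.symm Θ.target ∧
      ∀ y ∈ Θ.source, (Θ y).1 = f y := by
  let φ : OpenPartialHomeomorph M E :=
    (chartAt H x).trans I.toHomeomorph.toOpenPartialHomeomorph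
  have hφs : φ.source = (chartAt H x).source := by simp [φ]
  have hφ : ContMDiffOn I 𝓘(ℝ, E) ∞ φ φ.source := by
    rw [hφs]; exact contMDiffOn_extChartAt
  have hφt : φ.target = (extChartAt I x).target := by
    simp only [φ, OpenPartialHomeomorph.trans_target, extChartAt_target, I.range_eq_univ]
    ext t; simp
  have hφsymm : ContMDiffOn 𝓘(ℝ, E) I ∞ φ.symm φ.target := by
    rw [hφt]; exact contMDiffOn_extChartAt_symm x
  have hxφ : x ∈ φ.source := by rw [hφs]; exact mem_chart_source H x
  let V : Set E := φ.target ∩ φ.symm ⁻¹' U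
  have hV : IsOpen V := φ.symm.isOpen_inter_preimage hU
  have hxV : φ x ∈ V := ⟨φ.map_source hxφ, by
    change φ.symm (φ x) ∈ U; rw [φ.left_inv hxφ]; exact hxU⟩
  have hfV : ContDiffOn ℝ ∞ (f ∘ φ.symm) V :=
    (hf.comp (hφsymm.mono inter_subset_left) inter_subset_right).contDiffOn
  have hfx : MDifferentiableAt I 𝓘(ℝ, F) f x :=
    (hf.contMDiffAt (hU.mem_nhds hxU)).mdifferentiableAt (by simp)
  have hsV : Function.Surjective (fderiv ℝ (f ∘ φ.symm) (φ x)) := by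
    have h1 : MDifferentiableAt 𝓘(ℝ, E) 𝓘(ℝ, F) (f ∘ φ.symm) (φ x) :=
      (hfV.contDiffAt (hV.mem_nhds hxV)).differentiableAt (by simp) |>.mdifferentiableAt
    have h2 : MDifferentiableAt I 𝓘(ℝ, E) φ x :=
      (hφ.contMDiffAt (φ.open_source.mem_nhds hxφ)).mdifferentiableAt (by simp)
    have h3 : (f ∘ φ.symm) ∘ φ =ᶠ[𝓝 x] f := by
      filter_upwards [φ.open_source.mem_nhds hxφ] with y hy
      simp [φ.left_inv hy]
    have h4 := h3.mfderiv_eq (I := I) (I' := 𝓘(ℝ, F))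
    rw [mfderiv_comp x h1 h2, mfderiv_eq_fderiv] at h4
    intro w
    obtain ⟨v, hv⟩ := hs w
    refine ⟨mfderiv I 𝓘(ℝ, E) φ x v, ?_⟩
    rw [← hv, ← h4]; rfl
  obtain ⟨R, hxR, hRV, hR, hR', hRf⟩ := _root_.exists_straightening hd hV hxV hfV hsV
  refine ⟨φ.trans R, ?_, ?_, ?_, ?_, ?_⟩
  · exact ⟨hxφ, hxR⟩
  · intro y hy
    rw [OpenPartialHomeomorph.trans_source] at hy
    have h1 := (hRV hy.2).2
    change φ.symm (φ y) ∈ U at h1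
    rwa [φ.left_inv hy.1] at h1
  · rw [OpenPartialHomeomorph.coe_trans, OpenPartialHomeomorph.trans_source]
    exact hR.contMDiffOn.comp (hφ.mono inter_subset_left) inter_subset_right
  · rw [OpenPartialHomeomorph.coe_trans_symm, OpenPartialHomeomorph.trans_target]
    exact hφsymm.comp (hR'.contMDiffOn.mono inter_subset_left) inter_subset_right
  · intro y hy
    rw [OpenPartialHomeomorph.trans_source] at hy
    rw [OpenPartialHomeomorph.coe_trans, Function.comp_apply, hRf _ hy.2, Function.comp_apply,
      φ.left_inv hy.1]

theorem IsLevelAt.exists_straightening {x : M}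
    (hd : Module.finrank ℝ E - Module.finrank ℝ F = d) (h : IsLevelAt I F p x) :
    ∃ Θ : OpenPartialHomeomorph M (F × EuclideanSpace ℝ (Fin d)),
      x ∈ Θ.source ∧ ContMDiffOn I 𝓘(ℝ, F × EuclideanSpace ℝ (Fin d)) ∞ Θ Θ.source ∧
      ContMDiffOn 𝓘(ℝ, F × EuclideanSpace ℝ (Fin d)) I ∞ Θ.symm Θ.target ∧
      ∀ y ∈ Θ.source, p y ↔ (Θ y).1 = 0 := by
  obtain ⟨U, f, hU, hxU, hf, hs, hp⟩ := h
  obtain ⟨Θ, h1, h2, h3, h4, h5⟩ := exists_manifold_straightening hd hU hxU hf hs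
  exact ⟨Θ, h1, h3, h4, fun y hy => by rw [h5 y hy]; exact hp y (h2 hy)⟩

open Classical in
/-- The chart of `{y // p y}` cut out by a straightening diffeomorphism of `M`. -/
noncomputable def sliceChart (Θ : OpenPartialHomeomorph M (F × EuclideanSpace ℝ (Fin d)))
    (hΘ : ∀ y ∈ Θ.source, p y ↔ (Θ y).1 = 0) (x : {y // p y}) :
    OpenPartialHomeomorph {y // p y} (EuclideanSpace ℝ (Fin d)) where
  toFun y := (Θ y).2
  invFun t := if h : p (Θ.symm (0, t)) then ⟨Θ.symm (0, t), h⟩ else x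
  source := {y | (y : M) ∈ Θ.source}
  target := {t | ((0, t) : F × EuclideanSpace ℝ (Fin d)) ∈ Θ.target}
  map_source' y hy := by
    have h1 : ((0, (Θ y).2) : F × EuclideanSpace ℝ (Fin d)) = Θ y :=
      Prod.ext ((hΘ y hy).1 y.2).symm rfl
    change (0, (Θ y).2) ∈ Θ.target
    rw [h1]; exact Θ.map_source hy
  map_target' t ht := by
    have h1 : p (Θ.symm (0, t)) := by
      rw [hΘ _ (Θ.map_target ht), Θ.right_inv ht]
    simp only [h1, dif_pos]
    exact Θ.map_target ht
  left_inv' y hy := by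
    have h1 : ((0, (Θ y).2) : F × EuclideanSpace ℝ (Fin d)) = Θ y :=
      Prod.ext ((hΘ y hy).1 y.2).symm rfl
    have h2 : Θ.symm (0, (Θ y).2) = y := by rw [h1]; exact Θ.left_inv hy
    apply Subtype.ext
    rw [dif_pos (by rw [h2]; exact y.2)]
    exact h2
  right_inv' t ht := by
    have h1 : p (Θ.symm (0, t)) := by
      rw [hΘ _ (Θ.map_target ht), Θ.right_inv ht]
    simp only [h1, dif_pos]
    rw [Θ.right_inv ht]
  open_source := Θ.open_source.preimage continuous_subtype_val
  open_target := Θ.open_target.preimage (by fun_prop)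
  continuousOn_toFun := continuous_snd.comp_continuousOn
    (Θ.continuousOn.comp continuous_subtype_val.continuousOn fun _ hy => hy)
  continuousOn_invFun := by
    refine Topology.IsInducing.subtypeVal.continuousOn_iff.2 ?_
    have h0 : ContinuousOn (fun t : EuclideanSpace ℝ (Fin d) => Θ.symm ((0 : F), t))
        {t | ((0, t) : F × EuclideanSpace ℝ (Fin d)) ∈ Θ.target} :=
      Θ.symm.continuousOn.comp (by fun_prop) fun _ ht => ht
    refine h0.congr fun t ht => ?_
    have h1 : p (Θ.symm (0, t)) := by
      rw [hΘ _ (Θ.map_target ht), Θ.right_inv ht]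
    simp [h1]

theorem IsLevelAt.exists_chart (x : {y // p y})
    (hd : Module.finrank ℝ E - Module.finrank ℝ F = d) (h : IsLevelAt I F p x) :
    ∃ ψ : OpenPartialHomeomorph {y // p y} (EuclideanSpace ℝ (Fin d)),
      IsSubmanifoldChart I p ψ ∧ x ∈ ψ.source := by
  obtain ⟨Θ, hx, hs, hs', hΘ⟩ := h.exists_straightening hd
  refine ⟨sliceChart Θ hΘ x, ⟨?_, ?_⟩, hx⟩
  · have h0 : ContMDiffOn (𝓡 d) I ∞ (fun t : EuclideanSpace ℝ (Fin d) => Θ.symm ((0 : F), t))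
        {t | ((0, t) : F × EuclideanSpace ℝ (Fin d)) ∈ Θ.target} := by
      refine hs'.comp (t := Θ.target) ?_ fun _ ht => ht
      have : ContDiff ℝ ∞ (fun t : EuclideanSpace ℝ (Fin d) => ((0 : F), t)) := by fun_prop
      exact this.contMDiff.contMDiffOn
    refine h0.congr fun t ht => ?_
    have h1 : p (Θ.symm (0, t)) := by
      rw [hΘ _ (Θ.map_target ht), Θ.right_inv ht]
    simp [sliceChart, h1]
  · intro y hy
    refine ⟨Θ.source, fun z => (Θ z).2, Θ.open_source, hy, ?_, fun _ _ _ => rfl⟩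
    have : ContDiff ℝ ∞ (Prod.snd : F × EuclideanSpace ℝ (Fin d) → _) := contDiff_snd
    exact this.contMDiff.comp_contMDiffOn hs

/-- The manifold structure of a subspace `{y // p y}` that is locally a regular level set: its charts are all
submanifold charts. -/
@[reducible] noncomputable def levelChartedSpace
    (hd : Module.finrank ℝ E - Module.finrank ℝ F = d)
    (h : ∀ x : {y // p y}, IsLevelAt I F p x) :
    ChartedSpace (EuclideanSpace ℝ (Fin d)) {y // p y} where
  atlas := {ψ | IsSubmanifoldChart I p ψ}
  chartAt x := ((h x).exists_chart x hd).choose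
  mem_chart_source x := ((h x).exists_chart x hd).choose_spec.2
  chart_mem_atlas x := ((h x).exists_chart x hd).choose_spec.1

/-- A charted space structure on `{y // p y}` is a submanifold structure if all its charts are submanifold charts. -/
def IsSubmanifold (I : ModelWithCorners ℝ E H) (p : M → Prop) (d : ℕ)
    [ChartedSpace (EuclideanSpace ℝ (Fin d)) {y // p y}] : Prop :=
  ∀ ψ ∈ atlas (EuclideanSpace ℝ (Fin d)) {y // p y}, IsSubmanifoldChart I p ψ

theorem isSubmanifold_levelChartedSpace (hd : Module.finrank ℝ E - Module.finrank ℝ F = d)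
    (h : ∀ x : {y // p y}, IsLevelAt I F p x) :
    letI := levelChartedSpace hd h
    IsSubmanifold I p d := fun _ hψ => hψ

namespace IsSubmanifold

variable [ChartedSpace (EuclideanSpace ℝ (Fin d)) {y // p y}]

theorem isManifold (h : IsSubmanifold I p d) : IsManifold (𝓡 d) ∞ {y // p y} := by
  refine isManifold_of_contDiffOn _ _ _ fun e e' he he' => ?_
  obtain ⟨h1, -⟩ := h e he
  obtain ⟨-, h2⟩ := h e' he'
  simp only [modelWithCornersSelf_coe, modelWithCornersSelf_coe_symm, Function.id_comp,
    Function.comp_id, preimage_id_eq, id_eq, range_id, inter_univ]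
  rintro t ht
  have ht1 : t ∈ e.target := ht.1
  have ht2 : e.symm t ∈ e'.source := ht.2
  obtain ⟨U, g, hU, hyU, hg, hgy⟩ := h2 _ ht2
  have h3 : ContMDiffAt (𝓡 d) (𝓡 d) ∞ (g ∘ fun t => (e.symm t : M)) t :=
    (hg.contMDiffAt (hU.mem_nhds hyU)).comp t (h1.contMDiffAt (e.open_target.mem_nhds ht1))
  refine (h3.contDiffAt.congr_of_eventuallyEq ?_).contDiffWithinAt
  have hc : ContinuousAt e.symm t := e.symm.continuousAt ht1
  filter_upwards [hc.preimage_mem_nhds (e'.open_source.mem_nhds ht2),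
    hc.preimage_mem_nhds ((hU.preimage continuous_subtype_val).mem_nhds hyU)] with s hs hs'
  exact hgy _ hs hs'

/-- The inclusion of a submanifold is smooth. -/
theorem contMDiff_coe (h : IsSubmanifold I p d) :
    ContMDiff (𝓡 d) I ∞ (Subtype.val : {y // p y} → M) := by
  have := h.isManifold
  intro x
  obtain ⟨h1, -⟩ := h _ (chart_mem_atlas _ x)
  have hx := mem_chart_source (EuclideanSpace ℝ (Fin d)) x
  have h2 := (h1.contMDiffAt ((chartAt _ x).open_target.mem_nhds ((chartAt _ x).map_source hx)))
  have h3 : ContMDiffAt (𝓡 d) (𝓡 d) ∞ (chartAt (EuclideanSpace ℝ (Fin d)) x) x :=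
    contMDiffOn_chart.contMDiffAt ((chartAt _ x).open_source.mem_nhds hx)
  refine (h2.comp x h3).congr_of_eventuallyEq ?_
  filter_upwards [(chartAt _ x).open_source.mem_nhds hx] with y hy
  simp [(chartAt (EuclideanSpace ℝ (Fin d)) x).left_inv hy]

/-- A map into a submanifold is smooth if it is smooth as a map into the ambient manifold. -/
theorem contMDiffAt_of_coe (h : IsSubmanifold I p d) {E' H' N : Type*} [NormedAddCommGroup E']
    [NormedSpace ℝ E'] [TopologicalSpace H'] {J : ModelWithCorners ℝ E' H'} [TopologicalSpace N]
    [ChartedSpace H' N] {f : N → {y // p y}} {x : N}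
    (hf : ContMDiffAt J I ∞ (fun z => (f z : M)) x) : ContMDiffAt J (𝓡 d) ∞ f x := by
  have := h.isManifold
  have hc : ContinuousAt f x := Topology.IsInducing.subtypeVal.continuousAt_iff.2 hf.continuousAt
  obtain ⟨h1, h2⟩ := h _ (chart_mem_atlas _ (f x))
  set e := chartAt (EuclideanSpace ℝ (Fin d)) (f x)
  have hx : f x ∈ e.source := mem_chart_source (EuclideanSpace ℝ (Fin d)) (f x)
  obtain ⟨U, g, hU, hyU, hg, hgy⟩ := h2 _ hx
  have h3 : ContMDiffAt J (𝓡 d) ∞ (g ∘ fun z => (f z : M)) x :=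
    (hg.contMDiffAt (hU.mem_nhds hyU)).comp x hf
  have h4 : ContMDiffAt J (𝓡 d) ∞ (e ∘ f) x := by
    refine h3.congr_of_eventuallyEq ?_
    filter_upwards [hc.preimage_mem_nhds (e.open_source.mem_nhds hx),
      hc.preimage_mem_nhds ((hU.preimage continuous_subtype_val).mem_nhds hyU)] with s hs hs'
    exact hgy _ hs hs'
  have h5 : ContMDiffAt (𝓡 d) (𝓡 d) ∞ e.symm (e (f x)) :=
    contMDiffOn_chart_symm.contMDiffAt (e.open_target.mem_nhds (e.map_source hx))
  refine (h5.comp x h4).congr_of_eventuallyEq ?_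
  filter_upwards [hc.preimage_mem_nhds (e.open_source.mem_nhds hx)] with s hs
  exact (e.left_inv hs).symm

theorem contMDiff_of_coe (h : IsSubmanifold I p d) {E' H' N : Type*} [NormedAddCommGroup E']
    [NormedSpace ℝ E'] [TopologicalSpace H'] {J : ModelWithCorners ℝ E' H'} [TopologicalSpace N]
    [ChartedSpace H' N] {f : N → {y // p y}}
    (hf : ContMDiff J I ∞ (fun z => (f z : M))) : ContMDiff J (𝓡 d) ∞ f :=
  fun x => h.contMDiffAt_of_coe (hf x)

/-- The tangent space of a level set contains the kernel of the differential of the function defining it. -/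
theorem exists_mfderiv_coe_eq (h : IsSubmanifold I p d)
    (hd : Module.finrank ℝ E - Module.finrank ℝ F = d) {U : Set M} {f : M → F} (x : {y // p y})
    (hU : IsOpen U) (hxU : (x : M) ∈ U) (hf : ContMDiffOn I 𝓘(ℝ, F) ∞ f U)
    (hs : Function.Surjective (mfderiv I 𝓘(ℝ, F) f x)) (hp : ∀ y ∈ U, p y ↔ f y = 0)
    (v : TangentSpace I (x : M)) (hv : mfderiv I 𝓘(ℝ, F) f x v = 0) :
    ∃ w : TangentSpace (𝓡 d) x, mfderiv (𝓡 d) I (Subtype.val : {y // p y} → M) x w = v := by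
  classical
  obtain ⟨Θ, hxΘ, hΘU, hΘ, hΘ', hΘf⟩ := exists_manifold_straightening hd hU hxU hf hs
  let P : F × EuclideanSpace ℝ (Fin d) →L[ℝ] F × EuclideanSpace ℝ (Fin d) :=
    (0 : F × EuclideanSpace ℝ (Fin d) →L[ℝ] F).prod (ContinuousLinearMap.snd ℝ _ _)
  have hΘx : MDifferentiableAt I 𝓘(ℝ, F × EuclideanSpace ℝ (Fin d)) Θ x :=
    (hΘ.contMDiffAt (Θ.open_source.mem_nhds hxΘ)).mdifferentiableAt (by simp)
  have hPx : P (Θ x) = Θ x :=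
    Prod.ext (by rw [hΘf _ hxΘ, (hp _ hxU).1 x.2]; rfl) rfl
  have hΘ'x : ContMDiffAt 𝓘(ℝ, F × EuclideanSpace ℝ (Fin d)) I ∞ Θ.symm (Θ x) :=
    hΘ'.contMDiffAt (Θ.open_target.mem_nhds (Θ.map_source hxΘ))
  let r : M → M := fun y => Θ.symm (P (Θ y))
  have hPΘ : ContMDiffAt I 𝓘(ℝ, F × EuclideanSpace ℝ (Fin d)) ∞ (fun y => P (Θ y)) x :=
    P.contDiff.contMDiff.contMDiffAt.comp (x : M)
      (hΘ.contMDiffAt (Θ.open_source.mem_nhds hxΘ))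
  have hr : ContMDiffAt I I ∞ r x := by
    refine ContMDiffAt.comp (x : M) (g := Θ.symm) (f := fun y => P (Θ y)) ?_ hPΘ
    rwa [hPx]
  let σ : M → {y // p y} := fun y => if h : p (r y) then ⟨r y, h⟩ else x
  have hev : (fun y => (σ y : M)) =ᶠ[𝓝 (x : M)] r := by
    have h1 : (fun y => P (Θ y)) ⁻¹' Θ.target ∈ 𝓝 (x : M) :=
      hPΘ.continuousAt.preimage_mem_nhds
        (Θ.open_target.mem_nhds (by rw [hPx]; exact Θ.map_source hxΘ))
    filter_upwards [h1] with y hy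
    have h2 : p (r y) := by
      rw [hp _ (hΘU (Θ.map_target hy)), ← hΘf _ (Θ.map_target hy), Θ.right_inv hy]; rfl
    simp [σ, h2]
  have hσx : σ x = x := by
    have h1 : r x = x := by change Θ.symm (P (Θ x)) = x; rw [hPx, Θ.left_inv hxΘ]
    apply Subtype.ext
    rw [hev.eq_of_nhds]; exact h1
  have hσ : ContMDiffAt I (𝓡 d) ∞ σ x := h.contMDiffAt_of_coe (hr.congr_of_eventuallyEq hev)
  have h1 : mfderiv I I (fun y => (σ y : M)) x =
      (mfderiv (𝓡 d) I (Subtype.val : {y // p y} → M) (σ x)).comp (mfderiv I (𝓡 d) σ x) :=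
    mfderiv_comp (x : M) (h.contMDiff_coe.mdifferentiableAt (by simp))
      (hσ.mdifferentiableAt (by simp))
  have h2 : (mfderiv I I (fun y => (σ y : M)) x : E → E) = mfderiv I I r x := by
    rw [hev.mfderiv_eq]; rfl
  have h3 : mfderiv I I r x = (mfderiv 𝓘(ℝ, F × EuclideanSpace ℝ (Fin d)) I Θ.symm (P (Θ x))).comp
      (mfderiv I 𝓘(ℝ, F × EuclideanSpace ℝ (Fin d)) (fun y => P (Θ y)) x) :=
    mfderiv_comp (x : M) (by rw [hPx]; exact hΘ'x.mdifferentiableAt (by simp))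
      (hPΘ.mdifferentiableAt (by simp))
  have h4 : mfderiv I 𝓘(ℝ, F × EuclideanSpace ℝ (Fin d)) (fun y => P (Θ y)) x =
      P.comp (mfderiv I 𝓘(ℝ, F × EuclideanSpace ℝ (Fin d)) Θ x) := by
    have := mfderiv_comp (x : M) (I'' := 𝓘(ℝ, F × EuclideanSpace ℝ (Fin d)))
      (P.differentiableAt (x := Θ x)).mdifferentiableAt hΘx
    rw [mfderiv_eq_fderiv, P.fderiv] at this
    exact this
  have h5 : mfderiv I 𝓘(ℝ, F) f x v = (mfderiv I 𝓘(ℝ, F × EuclideanSpace ℝ (Fin d)) Θ x v :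
      F × EuclideanSpace ℝ (Fin d)).1 := by
    have h6 : (fun y => ContinuousLinearMap.fst ℝ F (EuclideanSpace ℝ (Fin d)) (Θ y))
        =ᶠ[𝓝 (x : M)] f := by
      filter_upwards [Θ.open_source.mem_nhds hxΘ] with y hy
      exact hΘf y hy
    have h7 := mfderiv_comp (x : M) (I'' := 𝓘(ℝ, F)) ((ContinuousLinearMap.fst ℝ F
      (EuclideanSpace ℝ (Fin d))).differentiableAt (x := Θ x)).mdifferentiableAt hΘx
    rw [mfderiv_eq_fderiv, ContinuousLinearMap.fderiv] at h7
    have h8 := h6.mfderiv_eq (I := I) (I' := 𝓘(ℝ, F))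
    rw [← h8]
    exact congrArg (fun D : E →L[ℝ] F => D v) h7
  have h9 : P (mfderiv I 𝓘(ℝ, F × EuclideanSpace ℝ (Fin d)) Θ x v) =
      mfderiv I 𝓘(ℝ, F × EuclideanSpace ℝ (Fin d)) Θ x v :=
    Prod.ext (by rw [← h5, hv]; rfl) rfl
  have h10 : (mfderiv 𝓘(ℝ, F × EuclideanSpace ℝ (Fin d)) I Θ.symm (Θ x)).comp
      (mfderiv I 𝓘(ℝ, F × EuclideanSpace ℝ (Fin d)) Θ x) =
      ContinuousLinearMap.id ℝ (TangentSpace I (x : M)) := by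
    rw [← mfderiv_id, ← mfderiv_comp (x : M) (hΘ'x.mdifferentiableAt (by simp)) hΘx]
    apply Filter.EventuallyEq.mfderiv_eq
    filter_upwards [Θ.open_source.mem_nhds hxΘ] with y hy
    exact Θ.left_inv hy
  have hcoe : ∀ y (_ : y = x) (w : EuclideanSpace ℝ (Fin d)),
      (mfderiv (𝓡 d) I (Subtype.val : {y // p y} → M) y w : E) =
        mfderiv (𝓡 d) I (Subtype.val : {y // p y} → M) x w := by
    rintro _ rfl _; rfl
  have hsymm : ∀ u (_ : u = Θ x) (w : F × EuclideanSpace ℝ (Fin d)),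
      (mfderiv 𝓘(ℝ, F × EuclideanSpace ℝ (Fin d)) I Θ.symm u w : E) =
        mfderiv 𝓘(ℝ, F × EuclideanSpace ℝ (Fin d)) I Θ.symm (Θ x) w := by
    rintro _ rfl _; rfl
  refine ⟨(mfderiv I (𝓡 d) σ x v : EuclideanSpace ℝ (Fin d)), ?_⟩
  have e1 : @Eq E (mfderiv (𝓡 d) I (Subtype.val : {y // p y} → M) (σ x) (mfderiv I (𝓡 d) σ x v))
      (mfderiv I I (fun y => (σ y : M)) x v) := by rw [h1]; rfl
  have e2 : @Eq E (mfderiv I I r x v)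
      (mfderiv 𝓘(ℝ, F × EuclideanSpace ℝ (Fin d)) I Θ.symm (P (Θ x))
        (P (mfderiv I 𝓘(ℝ, F × EuclideanSpace ℝ (Fin d)) Θ x v))) := by rw [h3, h4]; rfl
  have e3 : @Eq E (mfderiv 𝓘(ℝ, F × EuclideanSpace ℝ (Fin d)) I Θ.symm (Θ x)
      (mfderiv I 𝓘(ℝ, F × EuclideanSpace ℝ (Fin d)) Θ x v)) v :=
    congrArg (fun D : E →L[ℝ] E => D v) h10
  rw [h9] at e2
  exact ((hcoe _ hσx _).symm.trans (e1.trans ((congrFun h2 v).trans (e2.trans (hsymm _ hPx _))))).trans e3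

end IsSubmanifold

section EqLocus

variable {E' H' N : Type*} [NormedAddCommGroup E'] [NormedSpace ℝ E'] [FiniteDimensional ℝ E']
  [TopologicalSpace H'] {J : ModelWithCorners ℝ E' H'} [J.Boundaryless]
  [TopologicalSpace N] [ChartedSpace H' N] [IsManifold J ∞ N] {a b : M → N}

/-- The differential `mfderiv I J a x`, as a continuous linear map between the model vector spaces. -/
noncomputable def modelDeriv (I : ModelWithCorners ℝ E H) (J : ModelWithCorners ℝ E' H')
    (a : M → N) (x : M) : E →L[ℝ] E' := mfderiv I J a x

theorem mfderiv_extChartAt_sub (ha : ContMDiff I J ∞ a) (hb : ContMDiff I J ∞ b) {x : M}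
    (hx : a x = b x) (v : TangentSpace I x) :
    @Eq E' (mfderiv I 𝓘(ℝ, E') (fun y => extChartAt J (a x) (a y) - extChartAt J (a x) (b y)) x v)
      (modelDeriv I J a x v - modelDeriv I J b x v) := by
  have h1 : HasMFDerivAt I 𝓘(ℝ, E') (fun y => extChartAt J (a x) (a y)) x (mfderiv I J a x) := by
    have := HasMFDerivAt.comp x (mdifferentiableAt_extChartAt (I := J)
      (mem_chart_source H' (a x))).hasMFDerivAt (ha.mdifferentiableAt (by simp)).hasMFDerivAt
    rw [mfderiv_extChartAt_self] at this
    exact this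
  have h2 : HasMFDerivAt I 𝓘(ℝ, E') (fun y => extChartAt J (a x) (b y)) x (mfderiv I J b x) := by
    rw [hx]
    have := HasMFDerivAt.comp x (mdifferentiableAt_extChartAt (I := J)
      (mem_chart_source H' (b x))).hasMFDerivAt (hb.mdifferentiableAt (by simp)).hasMFDerivAt
    rw [mfderiv_extChartAt_self] at this
    exact this
  have h3 := (h1.sub h2).mfderiv
  exact congrArg (fun D : E →L[ℝ] E' => D v) h3

theorem contMDiffOn_extChartAt_sub (ha : ContMDiff I J ∞ a) (hb : ContMDiff I J ∞ b) (x : M) :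
    ContMDiffOn I 𝓘(ℝ, E') ∞ (fun y => extChartAt J (a x) (a y) - extChartAt J (a x) (b y))
      (a ⁻¹' (chartAt H' (a x)).source ∩ b ⁻¹' (chartAt H' (a x)).source) :=
  ContMDiffOn.sub
    (contMDiffOn_extChartAt.comp ha.contMDiffOn inter_subset_left)
    (contMDiffOn_extChartAt.comp hb.contMDiffOn inter_subset_right)

theorem extChartAt_sub_eq_zero_iff (hp : ∀ y, p y ↔ a y = b y) (x : M) :
    ∀ y ∈ a ⁻¹' (chartAt H' (a x)).source ∩ b ⁻¹' (chartAt H' (a x)).source,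
      p y ↔ extChartAt J (a x) (a y) - extChartAt J (a x) (b y) = 0 := by
  rintro y ⟨hya, hyb⟩
  rw [hp, sub_eq_zero]
  refine ⟨fun h => by rw [h], fun h => (extChartAt J (a x)).injOn ?_ ?_ h⟩
  · rw [extChartAt_source]; exact hya
  · rw [extChartAt_source]; exact hyb

/-- The locus `{y | a y = b y}` of two smooth maps whose differentials have surjective difference is locally a
regular level set. -/
theorem isLevelAt_of_eq (ha : ContMDiff I J ∞ a) (hb : ContMDiff I J ∞ b)
    (hp : ∀ y, p y ↔ a y = b y) {x : M} (hx : p x)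
    (hs : Function.Surjective fun v => modelDeriv I J a x v - modelDeriv I J b x v) :
    IsLevelAt I E' p x := by
  refine ⟨a ⁻¹' (chartAt H' (a x)).source ∩ b ⁻¹' (chartAt H' (a x)).source,
    fun y => extChartAt J (a x) (a y) - extChartAt J (a x) (b y), ?_, ?_,
    contMDiffOn_extChartAt_sub ha hb x, ?_, extChartAt_sub_eq_zero_iff hp x⟩
  · exact ((chartAt H' (a x)).open_source.preimage ha.continuous).inter
      ((chartAt H' (a x)).open_source.preimage hb.continuous)
  · refine ⟨mem_chart_source H' (a x), ?_⟩
    change b x ∈ (chartAt H' (a x)).source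
    rw [← (hp x).1 hx]; exact mem_chart_source H' (a x)
  · intro w
    obtain ⟨v, hv⟩ := hs w
    exact ⟨v, (mfderiv_extChartAt_sub ha hb ((hp x).1 hx) v).trans hv⟩

/-- A vector on which the differentials of `a` and `b` agree is tangent to the locus `{y | a y = b y}`. -/
theorem IsSubmanifold.exists_mfderiv_coe_eq_of_eq
    [ChartedSpace (EuclideanSpace ℝ (Fin d)) {y // p y}] (h : IsSubmanifold I p d)
    (hd : Module.finrank ℝ E - Module.finrank ℝ E' = d)
    (ha : ContMDiff I J ∞ a) (hb : ContMDiff I J ∞ b)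
    (hp : ∀ y, p y ↔ a y = b y) (x : {y // p y})
    (hs : Function.Surjective fun v => modelDeriv I J a x v - modelDeriv I J b x v)
    (v : E) (hv : modelDeriv I J a x v = modelDeriv I J b x v) :
    ∃ w : TangentSpace (𝓡 d) x,
      @Eq E (mfderiv (𝓡 d) I (Subtype.val : {y // p y} → M) x w) v := by
  refine h.exists_mfderiv_coe_eq (F := E') hd
    (U := a ⁻¹' (chartAt H' (a x)).source ∩ b ⁻¹' (chartAt H' (a x)).source)
    (f := fun y => extChartAt J (a x) (a y) - extChartAt J (a x) (b y)) x ?_ ?_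
    (contMDiffOn_extChartAt_sub ha hb x) ?_ (extChartAt_sub_eq_zero_iff hp x) v ?_
  · exact ((chartAt H' (a x)).open_source.preimage ha.continuous).inter
      ((chartAt H' (a x)).open_source.preimage hb.continuous)
  · refine ⟨mem_chart_source H' (a x), ?_⟩
    change b x ∈ (chartAt H' (a x)).source
    rw [← (hp x).1 x.2]; exact mem_chart_source H' (a x)
  · intro w
    obtain ⟨v, hv⟩ := hs w
    exact ⟨v, (mfderiv_extChartAt_sub ha hb ((hp x).1 x.2) v).trans hv⟩
  · exact (mfderiv_extChartAt_sub ha hb ((hp x).1 x.2) v).trans (sub_eq_zero.2 hv)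

end EqLocus

end Submanifold

/-! ### Groupoids and Lie groupoids -/

/-- A groupoid with set of arrows `G` and set of objects `Q`, with source `src`, target `tgt`, identities `unit`, inversion
`inv`, and multiplication `mul` defined on the composable pairs `(g, h)`, those with `tgt g = src h`. -/
structure GroupoidOver (G Q : Type*) where
  src : G → Q
  tgt : G → Q
  unit : Q → G
  inv : G → G
  mul : {z : G × G // tgt z.1 = src z.2} → G
  src_mul : ∀ z, src (mul z) = src z.1.1
  tgt_mul : ∀ z, tgt (mul z) = tgt z.1.2
  mul_assoc : ∀ (g h k : G) (hgh : tgt g = src h) (hhk : tgt h = src k),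
    mul ⟨(mul ⟨(g, h), hgh⟩, k), (tgt_mul ⟨(g, h), hgh⟩).trans hhk⟩ =
      mul ⟨(g, mul ⟨(h, k), hhk⟩), hgh.trans (src_mul ⟨(h, k), hhk⟩).symm⟩
  src_unit : ∀ q, src (unit q) = q
  tgt_unit : ∀ q, tgt (unit q) = q
  unit_mul : ∀ g, mul ⟨(unit (src g), g), tgt_unit _⟩ = g
  mul_unit : ∀ g, mul ⟨(g, unit (tgt g)), (src_unit _).symm⟩ = g
  src_inv : ∀ g, src (inv g) = tgt g
  tgt_inv : ∀ g, tgt (inv g) = src g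
  mul_inv : ∀ g, mul ⟨(g, inv g), (src_inv g).symm⟩ = unit (src g)
  inv_mul : ∀ g, mul ⟨(inv g, g), tgt_inv g⟩ = unit (tgt g)

namespace GroupoidOver

variable {G Q : Type*} (𝒢 : GroupoidOver G Q)

/-- The set `G₂` of composable pairs. -/
abbrev Composable : Type _ := {z : G × G // 𝒢.tgt z.1 = 𝒢.src z.2}

/-- The fibre of the source map over `q`. -/
abbrev SrcFiber (q : Q) : Type _ := {g : G // 𝒢.src g = q}

/-- The set of arrows of the prolongation of the groupoid over its source map: triples `(g, h, r)` of arrows with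
`src g = src h` and `tgt h = src r`. -/
abbrev Prolongation : Type _ :=
  {x : G × G × G // 𝒢.src x.1 = 𝒢.src x.2.1 ∧ 𝒢.tgt x.2.1 = 𝒢.src x.2.2}

/-- The prolongation of a groupoid over its source map, a groupoid over `G`. -/
def prolongation : GroupoidOver 𝒢.Prolongation G where
  src x := x.1.1
  tgt x := x.1.2.2
  unit g := ⟨(g, 𝒢.unit (𝒢.src g), g), (𝒢.src_unit _).symm, 𝒢.tgt_unit _⟩
  inv x := ⟨(x.1.2.2, 𝒢.inv x.1.2.1, x.1.1),
    ((𝒢.src_inv _).trans x.2.2).symm, (𝒢.tgt_inv _).trans x.2.1.symm⟩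
  mul z := ⟨(z.1.1.1.1, 𝒢.mul ⟨(z.1.1.1.2.1, z.1.2.1.2.1),
      z.1.1.2.2.trans ((congrArg 𝒢.src z.2).trans z.1.2.2.1)⟩, z.1.2.1.2.2),
    z.1.1.2.1.trans (𝒢.src_mul ⟨(z.1.1.1.2.1, z.1.2.1.2.1), _⟩).symm,
    (𝒢.tgt_mul ⟨(z.1.1.1.2.1, z.1.2.1.2.1), _⟩).trans z.1.2.2.2⟩
  src_mul _ := rfl
  tgt_mul _ := rfl
  mul_assoc g h k _ _ := Subtype.ext (Prod.ext rfl (Prod.ext (𝒢.mul_assoc _ _ _ _ _) rfl))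
  src_unit _ := rfl
  tgt_unit _ := rfl
  unit_mul x := by
    obtain ⟨⟨g, h, r⟩, h1, h2⟩ := x
    dsimp only at h1 h2
    simp only [h1, 𝒢.unit_mul]
  mul_unit x := by
    obtain ⟨⟨g, h, r⟩, h1, h2⟩ := x
    dsimp only at h1 h2
    simp only [← h2, 𝒢.mul_unit]
  src_inv _ := rfl
  tgt_inv _ := rfl
  mul_inv x := by
    obtain ⟨⟨g, h, r⟩, h1, h2⟩ := x
    dsimp only at h1 h2
    simp only [h1, 𝒢.mul_inv]
  inv_mul x := by
    obtain ⟨⟨g, h, r⟩, h1, h2⟩ := x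
    dsimp only at h1 h2
    simp only [← h2, 𝒢.inv_mul]

/-- The inclusion `(g, h) ↦ (g, g, h)` of the composable pairs into the prolongation. -/
def inclusion (z : 𝒢.Composable) : 𝒢.Prolongation := ⟨(z.1.1, z.1.1, z.1.2), rfl, z.2⟩

/-- Left translation by `g`, from the source fibre of `tgt g` to the source fibre of `src g`. -/
def leftTranslation (g : G) (h : 𝒢.SrcFiber (𝒢.tgt g)) : 𝒢.SrcFiber (𝒢.src g) :=
  ⟨𝒢.mul ⟨(g, h.1), h.2.symm⟩, 𝒢.src_mul _⟩

/-- Inversion followed by right translation by `g`: the map `h ↦ h⁻¹ g` on the source fibre of `src g`. -/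
def rightTranslationInv (g : G) (h : 𝒢.SrcFiber (𝒢.src g)) : G :=
  𝒢.mul ⟨(𝒢.inv h.1, g), (𝒢.tgt_inv _).trans h.2⟩

theorem inv_unit_mul (g : G) : 𝒢.rightTranslationInv g ⟨𝒢.unit (𝒢.src g), 𝒢.src_unit _⟩ = g := by
  have h : 𝒢.inv (𝒢.unit (𝒢.src g)) = 𝒢.unit (𝒢.src g) := by
    have h1 := 𝒢.mul_inv (𝒢.unit (𝒢.src g))
    have h2 := 𝒢.unit_mul (𝒢.inv (𝒢.unit (𝒢.src g)))
    simp only [𝒢.src_inv, 𝒢.tgt_unit] at h2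
    rw [𝒢.src_unit] at h1
    exact h2.symm.trans h1
  simp only [rightTranslationInv, h, 𝒢.unit_mul]

theorem unit_mul_unit (o : Q) :
    𝒢.mul ⟨(𝒢.unit o, 𝒢.unit o), (𝒢.tgt_unit o).trans (𝒢.src_unit o).symm⟩ = 𝒢.unit o := by
  have h := 𝒢.unit_mul (𝒢.unit o)
  simp only [𝒢.src_unit] at h
  exact h

theorem eq_unit_of_mul_self {g : G} (hg : 𝒢.tgt g = 𝒢.src g) (h : 𝒢.mul ⟨(g, g), hg⟩ = g) :
    g = 𝒢.unit (𝒢.src g) := by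
  have h1 := 𝒢.mul_assoc (𝒢.inv g) g g (𝒢.tgt_inv g) hg
  have h2 := 𝒢.inv_mul g
  have h3 := 𝒢.unit_mul g
  simp only [h, h2, hg, h3] at h1
  exact h1

/-- The identity at `q`, as a point of the source fibre of `q`. -/
def fiberUnit (q : Q) : 𝒢.SrcFiber q := ⟨𝒢.unit q, 𝒢.src_unit q⟩

end GroupoidOver

/-- A groupoid with smooth source and target maps that are submersions. -/
structure SubmersiveGroupoid (n q : ℕ) (G Q : Type*) [TopologicalSpace G]
    [ChartedSpace (EuclideanSpace ℝ (Fin n)) G] [TopologicalSpace Q]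
    [ChartedSpace (EuclideanSpace ℝ (Fin q)) Q] extends GroupoidOver G Q where
  contMDiff_src : ContMDiff (𝓡 n) (𝓡 q) ∞ src
  contMDiff_tgt : ContMDiff (𝓡 n) (𝓡 q) ∞ tgt
  surjective_mfderiv_src : ∀ g, Function.Surjective (mfderiv (𝓡 n) (𝓡 q) src g)
  surjective_mfderiv_tgt : ∀ g, Function.Surjective (mfderiv (𝓡 n) (𝓡 q) tgt g)

section ProdDeriv

variable {E₁ H₁ M₁ E₂ H₂ M₂ : Type*} [NormedAddCommGroup E₁] [NormedSpace ℝ E₁]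
  [TopologicalSpace H₁] {I₁ : ModelWithCorners ℝ E₁ H₁} [TopologicalSpace M₁] [ChartedSpace H₁ M₁]
  [NormedAddCommGroup E₂] [NormedSpace ℝ E₂]
  [TopologicalSpace H₂] {I₂ : ModelWithCorners ℝ E₂ H₂} [TopologicalSpace M₂] [ChartedSpace H₂ M₂]
  {E₃ H₃ M₃ : Type*} [NormedAddCommGroup E₃] [NormedSpace ℝ E₃]
  [TopologicalSpace H₃] {I₃ : ModelWithCorners ℝ E₃ H₃} [TopologicalSpace M₃] [ChartedSpace H₃ M₃]

theorem modelDeriv_comp_fst {f : M₁ → M₃} (hf : ContMDiff I₁ I₃ ∞ f) (x : M₁ × M₂)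
    (v : E₁ × E₂) :
    modelDeriv (I₁.prod I₂) I₃ (fun y : M₁ × M₂ => f y.1) x v = modelDeriv I₁ I₃ f x.1 v.1 := by
  have := (HasMFDerivAt.comp x (hf.mdifferentiableAt (by simp)).hasMFDerivAt
    (hasMFDerivAt_fst x)).mfderiv (I := I₁.prod I₂)
  exact congrArg (fun D : E₁ × E₂ →L[ℝ] E₃ => D v) this

theorem modelDeriv_comp_snd {f : M₂ → M₃} (hf : ContMDiff I₂ I₃ ∞ f) (x : M₁ × M₂)
    (v : E₁ × E₂) :
    modelDeriv (I₁.prod I₂) I₃ (fun y : M₁ × M₂ => f y.2) x v = modelDeriv I₂ I₃ f x.2 v.2 := by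
  have := (HasMFDerivAt.comp x (hf.mdifferentiableAt (by simp)).hasMFDerivAt
    (hasMFDerivAt_snd x)).mfderiv (I := I₁.prod I₂)
  exact congrArg (fun D : E₁ × E₂ →L[ℝ] E₃ => D v) this

theorem modelDeriv_prodMk {f : M₁ → M₂} {g : M₁ → M₃} (hf : ContMDiff I₁ I₂ ∞ f)
    (hg : ContMDiff I₁ I₃ ∞ g) (x : M₁) (v : E₁) :
    modelDeriv I₁ (I₂.prod I₃) (fun y => (f y, g y)) x v =
      (modelDeriv I₁ I₂ f x v, modelDeriv I₁ I₃ g x v) := by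
  have := ((hf.mdifferentiableAt (x := x) (by simp)).hasMFDerivAt.prodMk
    (hg.mdifferentiableAt (x := x) (by simp)).hasMFDerivAt).mfderiv
  exact congrArg (fun D : E₁ →L[ℝ] E₂ × E₃ => D v) this

end ProdDeriv

namespace SubmersiveGroupoid

variable {n q : ℕ} {G Q : Type*} [TopologicalSpace G] [ChartedSpace (EuclideanSpace ℝ (Fin n)) G]
  [IsManifold (𝓡 n) ∞ G] [TopologicalSpace Q] [ChartedSpace (EuclideanSpace ℝ (Fin q)) Q]
  [IsManifold (𝓡 q) ∞ Q] (𝒢 : SubmersiveGroupoid n q G Q)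

theorem surjective_modelDeriv_src (g : G) :
    Function.Surjective (modelDeriv (𝓡 n) (𝓡 q) 𝒢.src g) := 𝒢.surjective_mfderiv_src g

theorem surjective_modelDeriv_tgt (g : G) :
    Function.Surjective (modelDeriv (𝓡 n) (𝓡 q) 𝒢.tgt g) := 𝒢.surjective_mfderiv_tgt g

/-! #### The source fibres -/

theorem srcFiber_surjective (o : Q) (g : G) : Function.Surjective fun v =>
    modelDeriv (𝓡 n) (𝓡 q) 𝒢.src g v - modelDeriv (𝓡 n) (𝓡 q) (fun _ : G => o) g v := by
  intro w
  obtain ⟨v, hv⟩ := 𝒢.surjective_modelDeriv_src g w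
  refine ⟨v, ?_⟩
  have : modelDeriv (𝓡 n) (𝓡 q) (fun _ : G => o) g = 0 := mfderiv_const
  simp [hv, this]

theorem srcFiber_isLevelAt (o : Q) (g : 𝒢.SrcFiber o) :
    IsLevelAt (𝓡 n) (EuclideanSpace ℝ (Fin q)) (fun g => 𝒢.src g = o) (g : G) :=
  isLevelAt_of_eq 𝒢.contMDiff_src contMDiff_const (fun _ => Iff.rfl) g.2 (𝒢.srcFiber_surjective o g)

theorem srcFiber_finrank : Module.finrank ℝ (EuclideanSpace ℝ (Fin n)) -
    Module.finrank ℝ (EuclideanSpace ℝ (Fin q)) = n - q := by simp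

noncomputable instance (o : Q) :
    ChartedSpace (EuclideanSpace ℝ (Fin (n - q))) (𝒢.SrcFiber o) :=
  levelChartedSpace srcFiber_finrank (𝒢.srcFiber_isLevelAt o)

theorem srcFiber_isSubmanifold (o : Q) :
    IsSubmanifold (𝓡 n) (fun g => 𝒢.src g = o) (n - q) :=
  isSubmanifold_levelChartedSpace srcFiber_finrank (𝒢.srcFiber_isLevelAt o)

instance (o : Q) : IsManifold (𝓡 (n - q)) ∞ (𝒢.SrcFiber o) := (𝒢.srcFiber_isSubmanifold o).isManifold

/-! #### The composable pairs -/

theorem composable_surjective (z : G × G) : Function.Surjective fun v =>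
    modelDeriv ((𝓡 n).prod (𝓡 n)) (𝓡 q) (fun z : G × G => 𝒢.tgt z.1) z v -
      modelDeriv ((𝓡 n).prod (𝓡 n)) (𝓡 q) (fun z : G × G => 𝒢.src z.2) z v := by
  intro w
  obtain ⟨v, hv⟩ := 𝒢.surjective_modelDeriv_tgt z.1 w
  refine ⟨(v, 0), ?_⟩
  dsimp only
  rw [modelDeriv_comp_fst 𝒢.contMDiff_tgt, modelDeriv_comp_snd 𝒢.contMDiff_src]
  simp [hv]

theorem contMDiff_tgt_fst :
    ContMDiff ((𝓡 n).prod (𝓡 n)) (𝓡 q) ∞ (fun z : G × G => 𝒢.tgt z.1) :=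
  𝒢.contMDiff_tgt.comp contMDiff_fst

theorem contMDiff_src_snd :
    ContMDiff ((𝓡 n).prod (𝓡 n)) (𝓡 q) ∞ (fun z : G × G => 𝒢.src z.2) :=
  𝒢.contMDiff_src.comp contMDiff_snd

theorem composable_isLevelAt (z : 𝒢.Composable) :
    IsLevelAt ((𝓡 n).prod (𝓡 n)) (EuclideanSpace ℝ (Fin q))
      (fun z : G × G => 𝒢.tgt z.1 = 𝒢.src z.2) (z : G × G) :=
  isLevelAt_of_eq 𝒢.contMDiff_tgt_fst 𝒢.contMDiff_src_snd (fun _ => Iff.rfl) z.2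
    (𝒢.composable_surjective z)

theorem composable_finrank :
    Module.finrank ℝ (EuclideanSpace ℝ (Fin n) × EuclideanSpace ℝ (Fin n)) -
      Module.finrank ℝ (EuclideanSpace ℝ (Fin q)) = n + n - q := by simp

noncomputable instance : ChartedSpace (EuclideanSpace ℝ (Fin (n + n - q))) 𝒢.Composable :=
  levelChartedSpace composable_finrank 𝒢.composable_isLevelAt

theorem composable_isSubmanifold : IsSubmanifold ((𝓡 n).prod (𝓡 n))
    (fun z : G × G => 𝒢.tgt z.1 = 𝒢.src z.2) (n + n - q) :=
  isSubmanifold_levelChartedSpace composable_finrank 𝒢.composable_isLevelAt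

instance : IsManifold (𝓡 (n + n - q)) ∞ 𝒢.Composable := 𝒢.composable_isSubmanifold.isManifold

/-! #### The prolongation -/

/-- The map `(g, h, r) ↦ (src g, tgt h)`. -/
def prolongationLeft (x : G × G × G) : Q × Q := (𝒢.src x.1, 𝒢.tgt x.2.1)

/-- The map `(g, h, r) ↦ (src h, src r)`. -/
def prolongationRight (x : G × G × G) : Q × Q := (𝒢.src x.2.1, 𝒢.src x.2.2)

theorem contMDiff_prolongationLeft :
    ContMDiff ((𝓡 n).prod ((𝓡 n).prod (𝓡 n))) ((𝓡 q).prod (𝓡 q)) ∞ 𝒢.prolongationLeft :=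
  (𝒢.contMDiff_src.comp contMDiff_fst).prodMk
    (𝒢.contMDiff_tgt.comp (contMDiff_fst.comp contMDiff_snd))

theorem contMDiff_prolongationRight :
    ContMDiff ((𝓡 n).prod ((𝓡 n).prod (𝓡 n))) ((𝓡 q).prod (𝓡 q)) ∞ 𝒢.prolongationRight :=
  (𝒢.contMDiff_src.comp (contMDiff_fst.comp contMDiff_snd)).prodMk
    (𝒢.contMDiff_src.comp (contMDiff_snd.comp contMDiff_snd))

theorem modelDeriv_prolongationLeft (x : G × G × G) (v) :
    modelDeriv ((𝓡 n).prod ((𝓡 n).prod (𝓡 n))) ((𝓡 q).prod (𝓡 q)) 𝒢.prolongationLeft x v =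
      (modelDeriv (𝓡 n) (𝓡 q) 𝒢.src x.1 v.1, modelDeriv (𝓡 n) (𝓡 q) 𝒢.tgt x.2.1 v.2.1) := by
  have h1 := modelDeriv_prodMk (𝒢.contMDiff_src.comp contMDiff_fst) (𝒢.contMDiff_tgt_fst.comp
    (contMDiff_snd (I := 𝓡 n) (M := G) (J := (𝓡 n).prod (𝓡 n)) (N := G × G))) x v
  refine h1.trans (Prod.ext ?_ ?_)
  · exact modelDeriv_comp_fst 𝒢.contMDiff_src x v
  · exact (modelDeriv_comp_snd 𝒢.contMDiff_tgt_fst x v).trans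
      (modelDeriv_comp_fst 𝒢.contMDiff_tgt x.2 v.2)

theorem modelDeriv_prolongationRight (x : G × G × G) (v) :
    modelDeriv ((𝓡 n).prod ((𝓡 n).prod (𝓡 n))) ((𝓡 q).prod (𝓡 q)) 𝒢.prolongationRight x v =
      (modelDeriv (𝓡 n) (𝓡 q) 𝒢.src x.2.1 v.2.1, modelDeriv (𝓡 n) (𝓡 q) 𝒢.src x.2.2 v.2.2) := by
  have h0 : ContMDiff ((𝓡 n).prod (𝓡 n)) (𝓡 q) ∞ (fun z : G × G => 𝒢.src z.1) :=
    𝒢.contMDiff_src.comp contMDiff_fst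
  have h1 := modelDeriv_prodMk (h0.comp contMDiff_snd) (𝒢.contMDiff_src_snd.comp
    (contMDiff_snd (I := 𝓡 n) (M := G) (J := (𝓡 n).prod (𝓡 n)) (N := G × G))) x v
  refine h1.trans (Prod.ext ?_ ?_)
  · exact (modelDeriv_comp_snd h0 x v).trans (modelDeriv_comp_fst 𝒢.contMDiff_src x.2 v.2)
  · exact (modelDeriv_comp_snd 𝒢.contMDiff_src_snd x v).trans
      (modelDeriv_comp_snd 𝒢.contMDiff_src x.2 v.2)

theorem prolongation_surjective (x : G × G × G) : Function.Surjective fun v =>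
    modelDeriv ((𝓡 n).prod ((𝓡 n).prod (𝓡 n))) ((𝓡 q).prod (𝓡 q)) 𝒢.prolongationLeft x v -
      modelDeriv ((𝓡 n).prod ((𝓡 n).prod (𝓡 n))) ((𝓡 q).prod (𝓡 q)) 𝒢.prolongationRight x v := by
  rintro ⟨s, t⟩
  obtain ⟨u, hu⟩ := 𝒢.surjective_modelDeriv_src x.1 s
  obtain ⟨w, hw⟩ := 𝒢.surjective_modelDeriv_src x.2.2 (-t)
  refine ⟨(u, 0, w), ?_⟩
  dsimp only
  rw [modelDeriv_prolongationLeft, modelDeriv_prolongationRight]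
  simp [hu, hw]

theorem prolongation_iff (x : G × G × G) :
    (𝒢.src x.1 = 𝒢.src x.2.1 ∧ 𝒢.tgt x.2.1 = 𝒢.src x.2.2) ↔
      𝒢.prolongationLeft x = 𝒢.prolongationRight x := by
  simp [prolongationLeft, prolongationRight]

theorem prolongation_isLevelAt (x : 𝒢.Prolongation) :
    IsLevelAt ((𝓡 n).prod ((𝓡 n).prod (𝓡 n)))
      (EuclideanSpace ℝ (Fin q) × EuclideanSpace ℝ (Fin q))
      (fun x : G × G × G => 𝒢.src x.1 = 𝒢.src x.2.1 ∧ 𝒢.tgt x.2.1 = 𝒢.src x.2.2) x.1 :=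
  isLevelAt_of_eq 𝒢.contMDiff_prolongationLeft 𝒢.contMDiff_prolongationRight
    𝒢.prolongation_iff x.2 (𝒢.prolongation_surjective x.1)

theorem prolongation_finrank :
    Module.finrank ℝ (EuclideanSpace ℝ (Fin n) × EuclideanSpace ℝ (Fin n) ×
      EuclideanSpace ℝ (Fin n)) -
      Module.finrank ℝ (EuclideanSpace ℝ (Fin q) × EuclideanSpace ℝ (Fin q)) =
      n + (n + n) - (q + q) := by simp

noncomputable instance :
    ChartedSpace (EuclideanSpace ℝ (Fin (n + (n + n) - (q + q)))) 𝒢.Prolongation :=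
  levelChartedSpace prolongation_finrank 𝒢.prolongation_isLevelAt

theorem prolongation_isSubmanifold : IsSubmanifold ((𝓡 n).prod ((𝓡 n).prod (𝓡 n)))
    (fun x : G × G × G => 𝒢.src x.1 = 𝒢.src x.2.1 ∧ 𝒢.tgt x.2.1 = 𝒢.src x.2.2)
    (n + (n + n) - (q + q)) :=
  isSubmanifold_levelChartedSpace prolongation_finrank 𝒢.prolongation_isLevelAt

instance : IsManifold (𝓡 (n + (n + n) - (q + q))) ∞ 𝒢.Prolongation :=
  𝒢.prolongation_isSubmanifold.isManifold

theorem exists_mfderiv_prolongation_coe (x : 𝒢.Prolongation) (u v w : EuclideanSpace ℝ (Fin n))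
    (h1 : modelDeriv (𝓡 n) (𝓡 q) 𝒢.src x.1.1 u = modelDeriv (𝓡 n) (𝓡 q) 𝒢.src x.1.2.1 v)
    (h2 : modelDeriv (𝓡 n) (𝓡 q) 𝒢.tgt x.1.2.1 v = modelDeriv (𝓡 n) (𝓡 q) 𝒢.src x.1.2.2 w) :
    ∃ y, modelDeriv (𝓡 (n + (n + n) - (q + q))) ((𝓡 n).prod ((𝓡 n).prod (𝓡 n)))
      (Subtype.val : 𝒢.Prolongation → G × G × G) x y = (u, v, w) := by
  refine 𝒢.prolongation_isSubmanifold.exists_mfderiv_coe_eq_of_eq prolongation_finrank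
    𝒢.contMDiff_prolongationLeft 𝒢.contMDiff_prolongationRight 𝒢.prolongation_iff x
    (𝒢.prolongation_surjective x.1) (u, v, w) ?_
  rw [modelDeriv_prolongationLeft, modelDeriv_prolongationRight]
  exact Prod.ext h1 h2

end SubmersiveGroupoid

/-- A Lie groupoid `G ⇉ Q`, with `dim G = n` and `dim Q = q`. -/
structure LieGroupoid (n q : ℕ) (G Q : Type*) [TopologicalSpace G]
    [ChartedSpace (EuclideanSpace ℝ (Fin n)) G] [IsManifold (𝓡 n) ∞ G] [TopologicalSpace Q]
    [ChartedSpace (EuclideanSpace ℝ (Fin q)) Q] [IsManifold (𝓡 q) ∞ Q]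
    extends SubmersiveGroupoid n q G Q where
  contMDiff_unit : ContMDiff (𝓡 q) (𝓡 n) ∞ unit
  contMDiff_inv : ContMDiff (𝓡 n) (𝓡 n) ∞ inv
  contMDiff_mul : ContMDiff (M := toSubmersiveGroupoid.Composable) (𝓡 (n + n - q)) (𝓡 n) ∞ mul

section Cast

variable {E H M : Type*} [NormedAddCommGroup E] [NormedSpace ℝ E] [TopologicalSpace H]
  (I : ModelWithCorners ℝ E H) [TopologicalSpace M] [ChartedSpace H M]

/-- The identity map between the tangent spaces at two equal points. -/
noncomputable def tangentCast {x y : M} (h : x = y) : TangentSpace I x →L[ℝ] TangentSpace I y :=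
  h ▸ ContinuousLinearMap.id ℝ (TangentSpace I x)

theorem tangentCast_apply {x y : M} (h : x = y) (v : TangentSpace I x) :
    @Eq E (tangentCast I h v) v := by
  subst h; rfl

/-- The cotangent bundle of a manifold. -/
abbrev CotangentBundle (M : Type*) [TopologicalSpace M] [ChartedSpace H M] : Type _ :=
  Bundle.TotalSpace (E →L[ℝ] ℝ) (fun x : M => TangentSpace I x →L[ℝ] ℝ)

end Cast

namespace LieGroupoid

variable {n q : ℕ} {G Q : Type*} [TopologicalSpace G] [ChartedSpace (EuclideanSpace ℝ (Fin n)) G]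
  [IsManifold (𝓡 n) ∞ G] [TopologicalSpace Q] [ChartedSpace (EuclideanSpace ℝ (Fin q)) Q]
  [IsManifold (𝓡 q) ∞ Q] (𝒢 : LieGroupoid n q G Q)

/-! #### The prolongation of a Lie groupoid over its source map, as a Lie groupoid -/

theorem contMDiff_prolongation_coe : ContMDiff (𝓡 (n + (n + n) - (q + q)))
    ((𝓡 n).prod ((𝓡 n).prod (𝓡 n))) ∞ (Subtype.val : 𝒢.Prolongation → G × G × G) :=
  𝒢.prolongation_isSubmanifold.contMDiff_coe

theorem contMDiff_prolongation_fst : ContMDiff (𝓡 (n + (n + n) - (q + q))) (𝓡 n) ∞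
    (fun x : 𝒢.Prolongation => x.1.1) := contMDiff_fst.comp 𝒢.contMDiff_prolongation_coe

theorem contMDiff_prolongation_mid : ContMDiff (𝓡 (n + (n + n) - (q + q))) (𝓡 n) ∞
    (fun x : 𝒢.Prolongation => x.1.2.1) :=
  contMDiff_fst.comp (contMDiff_snd.comp 𝒢.contMDiff_prolongation_coe)

theorem contMDiff_prolongation_snd : ContMDiff (𝓡 (n + (n + n) - (q + q))) (𝓡 n) ∞
    (fun x : 𝒢.Prolongation => x.1.2.2) :=
  contMDiff_snd.comp (contMDiff_snd.comp 𝒢.contMDiff_prolongation_coe)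

theorem modelDeriv_prolongation_fst (x : 𝒢.Prolongation) (y) :
    modelDeriv (𝓡 (n + (n + n) - (q + q))) (𝓡 n) (fun x : 𝒢.Prolongation => x.1.1) x y =
      (modelDeriv (𝓡 (n + (n + n) - (q + q))) ((𝓡 n).prod ((𝓡 n).prod (𝓡 n)))
        (Subtype.val : 𝒢.Prolongation → G × G × G) x y).1 := by
  have := (HasMFDerivAt.comp x (hasMFDerivAt_fst x.1)
    (𝒢.contMDiff_prolongation_coe.mdifferentiableAt (by simp)).hasMFDerivAt).mfderiv
  exact congrArg (fun D : EuclideanSpace ℝ (Fin (n + (n + n) - (q + q))) →L[ℝ]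
    EuclideanSpace ℝ (Fin n) => D y) this

theorem modelDeriv_prolongation_snd (x : 𝒢.Prolongation) (y) :
    modelDeriv (𝓡 (n + (n + n) - (q + q))) (𝓡 n) (fun x : 𝒢.Prolongation => x.1.2.2) x y =
      (modelDeriv (𝓡 (n + (n + n) - (q + q))) ((𝓡 n).prod ((𝓡 n).prod (𝓡 n)))
        (Subtype.val : 𝒢.Prolongation → G × G × G) x y).2.2 := by
  have := (HasMFDerivAt.comp x ((hasMFDerivAt_snd x.1.2).comp x.1 (hasMFDerivAt_snd x.1))
    (𝒢.contMDiff_prolongation_coe.mdifferentiableAt (by simp)).hasMFDerivAt).mfderiv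
  exact congrArg (fun D : EuclideanSpace ℝ (Fin (n + (n + n) - (q + q))) →L[ℝ]
    EuclideanSpace ℝ (Fin n) => D y) this

/-- The prolongation, as a groupoid whose source and target maps are submersions. -/
noncomputable def submersiveProlongation :
    SubmersiveGroupoid (n + (n + n) - (q + q)) n 𝒢.Prolongation G where
  toGroupoidOver := 𝒢.toGroupoidOver.prolongation
  contMDiff_src := 𝒢.contMDiff_prolongation_fst
  contMDiff_tgt := 𝒢.contMDiff_prolongation_snd
  surjective_mfderiv_src x u := by
    obtain ⟨v, hv⟩ := 𝒢.surjective_modelDeriv_src x.1.2.1 (modelDeriv (𝓡 n) (𝓡 q) 𝒢.src x.1.1 u)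
    obtain ⟨w, hw⟩ := 𝒢.surjective_modelDeriv_src x.1.2.2 (modelDeriv (𝓡 n) (𝓡 q) 𝒢.tgt x.1.2.1 v)
    obtain ⟨y, hy⟩ := 𝒢.exists_mfderiv_prolongation_coe x u v w hv.symm hw.symm
    refine ⟨y, (𝒢.modelDeriv_prolongation_fst x y).trans ?_⟩
    rw [hy]
  surjective_mfderiv_tgt x w := by
    obtain ⟨v, hv⟩ := 𝒢.surjective_modelDeriv_tgt x.1.2.1 (modelDeriv (𝓡 n) (𝓡 q) 𝒢.src x.1.2.2 w)
    obtain ⟨u, hu⟩ := 𝒢.surjective_modelDeriv_src x.1.1 (modelDeriv (𝓡 n) (𝓡 q) 𝒢.src x.1.2.1 v)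
    obtain ⟨y, hy⟩ := 𝒢.exists_mfderiv_prolongation_coe x u v w hu hv
    refine ⟨y, (𝒢.modelDeriv_prolongation_snd x y).trans ?_⟩
    rw [hy]

/-- The prolongation of a Lie groupoid `G ⇉ Q` over its source map, as a Lie groupoid over `G`. -/
noncomputable def prolongation :
    LieGroupoid (n + (n + n) - (q + q)) n 𝒢.Prolongation G where
  toSubmersiveGroupoid := 𝒢.submersiveProlongation
  contMDiff_unit := 𝒢.prolongation_isSubmanifold.contMDiff_of_coe
    (f := 𝒢.toGroupoidOver.prolongation.unit)
    (contMDiff_id.prodMk ((𝒢.contMDiff_unit.comp 𝒢.contMDiff_src).prodMk contMDiff_id))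
  contMDiff_inv := 𝒢.prolongation_isSubmanifold.contMDiff_of_coe
    (f := 𝒢.toGroupoidOver.prolongation.inv)
    (𝒢.contMDiff_prolongation_snd.prodMk ((𝒢.contMDiff_inv.comp
      𝒢.contMDiff_prolongation_mid).prodMk 𝒢.contMDiff_prolongation_fst))
  contMDiff_mul := by
    have hc := 𝒢.submersiveProlongation.composable_isSubmanifold.contMDiff_coe
    have h1 := contMDiff_fst.comp hc
    have h2 := contMDiff_snd.comp hc
    have h3 := (𝒢.contMDiff_prolongation_mid.comp h1).prodMk
      (𝒢.contMDiff_prolongation_mid.comp h2)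
    let f : 𝒢.submersiveProlongation.Composable → 𝒢.Composable := fun z =>
      ⟨(z.1.1.1.2.1, z.1.2.1.2.1), z.1.1.2.2.trans ((congrArg 𝒢.src z.2).trans z.1.2.2.1)⟩
    have h4 := 𝒢.composable_isSubmanifold.contMDiff_of_coe (f := f) h3
    exact 𝒢.prolongation_isSubmanifold.contMDiff_of_coe
      (N := 𝒢.submersiveProlongation.Composable) (f := 𝒢.toGroupoidOver.prolongation.mul)
      ((𝒢.contMDiff_prolongation_fst.comp h1).prodMk
        ((𝒢.contMDiff_mul.comp h4).prodMk (𝒢.contMDiff_prolongation_snd.comp h2)))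

/-! #### The Lie algebroid and the cotangent groupoid -/

/-- The fibre at `o` of the Lie algebroid of a Lie groupoid: the tangent space at the identity of `o` of the source
fibre of `o`. -/
abbrev Algebroid (o : Q) : Type _ := TangentSpace (𝓡 (n - q)) (𝒢.fiberUnit o)

/-- The dual bundle of the Lie algebroid. -/
abbrev DualAlgebroid : Type _ :=
  Bundle.TotalSpace (EuclideanSpace ℝ (Fin (n - q)) →L[ℝ] ℝ) (fun o : Q => 𝒢.Algebroid o →L[ℝ] ℝ)

/-- The value at `g` of the left-invariant vector field of `a`: the image of `a` under the differential of left
translation by `g`. -/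
noncomputable def leftInvariant (g : G) : 𝒢.Algebroid (𝒢.tgt g) →L[ℝ] TangentSpace (𝓡 n) g :=
  (tangentCast (𝓡 n) (𝒢.mul_unit g)).comp
    (mfderiv (𝓡 (n - q)) (𝓡 n) (fun h : 𝒢.SrcFiber (𝒢.tgt g) => (𝒢.leftTranslation g h : G))
      (𝒢.fiberUnit (𝒢.tgt g)))

/-- The value at `g` of the right-invariant vector field of `a`: minus the image of `a` under the differential of
inversion followed by right translation by `g`. -/
noncomputable def rightInvariant (g : G) : 𝒢.Algebroid (𝒢.src g) →L[ℝ] TangentSpace (𝓡 n) g :=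
  -(tangentCast (𝓡 n) (𝒢.inv_unit_mul g)).comp
    (mfderiv (𝓡 (n - q)) (𝓡 n) (𝒢.rightTranslationInv g) (𝒢.fiberUnit (𝒢.src g)))

/-- The source map of the cotangent groupoid. -/
noncomputable def cotangentSrc (μ : CotangentBundle (𝓡 n) G) : 𝒢.DualAlgebroid :=
  ⟨𝒢.src μ.proj, μ.snd.comp (𝒢.rightInvariant μ.proj)⟩

/-- The target map of the cotangent groupoid. -/
noncomputable def cotangentTgt (μ : CotangentBundle (𝓡 n) G) : 𝒢.DualAlgebroid :=
  ⟨𝒢.tgt μ.proj, μ.snd.comp (𝒢.leftInvariant μ.proj)⟩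

/-- The submanifold of the cotangent bundle of the prolongation generated by a function `L` on the composable pairs: the
covectors at points of the image of the inclusion `i` of the composable pairs that satisfy `i^* μ = dL`. -/
def generatedSubmanifold (L : 𝒢.Composable → ℝ) :
    Set (CotangentBundle (𝓡 (n + (n + n) - (q + q))) 𝒢.Prolongation) :=
  {μ | ∃ (z : 𝒢.Composable) (ν : TangentSpace (𝓡 (n + (n + n) - (q + q))) (𝒢.inclusion z) →L[ℝ] ℝ),
    μ = ⟨𝒢.inclusion z, ν⟩ ∧ ∀ v : TangentSpace (𝓡 (n + n - q)) z,
      ν (mfderiv (𝓡 (n + n - q)) (𝓡 (n + (n + n) - (q + q))) 𝒢.inclusion z v) =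
        mfderiv (𝓡 (n + n - q)) 𝓘(ℝ, ℝ) L z v}

end LieGroupoid

/-- A morphism of Lie groupoids: a smooth map between the manifolds of arrows that preserves composability and products. -/
structure LieGroupoidHom {n q n' q' : ℕ} {G Q G' Q' : Type*}
    [TopologicalSpace G] [ChartedSpace (EuclideanSpace ℝ (Fin n)) G] [IsManifold (𝓡 n) ∞ G]
    [TopologicalSpace Q] [ChartedSpace (EuclideanSpace ℝ (Fin q)) Q] [IsManifold (𝓡 q) ∞ Q]
    [TopologicalSpace G'] [ChartedSpace (EuclideanSpace ℝ (Fin n')) G'] [IsManifold (𝓡 n') ∞ G']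
    [TopologicalSpace Q'] [ChartedSpace (EuclideanSpace ℝ (Fin q')) Q'] [IsManifold (𝓡 q') ∞ Q']
    (𝒢 : LieGroupoid n q G Q) (𝒢' : LieGroupoid n' q' G' Q') where
  toFun : G → G'
  contMDiff_toFun : ContMDiff (𝓡 n) (𝓡 n') ∞ toFun
  composable : ∀ z : 𝒢.Composable, 𝒢'.tgt (toFun z.1.1) = 𝒢'.src (toFun z.1.2)
  map_mul : ∀ z : 𝒢.Composable, toFun (𝒢.mul z) = 𝒢'.mul ⟨(toFun z.1.1, toFun z.1.2), composable z⟩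

namespace LieGroupoidHom

variable {n q n' q' : ℕ} {G Q G' Q' : Type*}
  [TopologicalSpace G] [ChartedSpace (EuclideanSpace ℝ (Fin n)) G] [IsManifold (𝓡 n) ∞ G]
  [TopologicalSpace Q] [ChartedSpace (EuclideanSpace ℝ (Fin q)) Q] [IsManifold (𝓡 q) ∞ Q]
  [TopologicalSpace G'] [ChartedSpace (EuclideanSpace ℝ (Fin n')) G'] [IsManifold (𝓡 n') ∞ G']
  [TopologicalSpace Q'] [ChartedSpace (EuclideanSpace ℝ (Fin q')) Q'] [IsManifold (𝓡 q') ∞ Q']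
  {𝒢 : LieGroupoid n q G Q} {𝒢' : LieGroupoid n' q' G' Q'} (χ : LieGroupoidHom 𝒢 𝒢')

/-- The map on objects induced by a morphism of Lie groupoids. -/
def base (o : Q) : Q' := 𝒢'.src (χ.toFun (𝒢.unit o))

theorem tgt_map_unit (o : Q) : 𝒢'.tgt (χ.toFun (𝒢.unit o)) = χ.base o :=
  χ.composable ⟨(𝒢.unit o, 𝒢.unit o), (𝒢.tgt_unit o).trans (𝒢.src_unit o).symm⟩

theorem map_unit (o : Q) : χ.toFun (𝒢.unit o) = 𝒢'.unit (χ.base o) := by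
  refine 𝒢'.eq_unit_of_mul_self (χ.tgt_map_unit o) ?_
  have h1 := χ.map_mul ⟨(𝒢.unit o, 𝒢.unit o), (𝒢.tgt_unit o).trans (𝒢.src_unit o).symm⟩
  rw [𝒢.unit_mul_unit] at h1
  exact h1.symm

theorem src_map (g : G) : 𝒢'.src (χ.toFun g) = χ.base (𝒢.src g) := by
  rw [← χ.tgt_map_unit]
  exact (χ.composable ⟨(𝒢.unit (𝒢.src g), g), 𝒢.tgt_unit _⟩).symm

theorem tgt_map (g : G) : 𝒢'.tgt (χ.toFun g) = χ.base (𝒢.tgt g) :=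
  χ.composable ⟨(g, 𝒢.unit (𝒢.tgt g)), (𝒢.src_unit _).symm⟩

/-- The restriction of a morphism to a source fibre. -/
def fiberMap (o : Q) (g : 𝒢.SrcFiber o) : 𝒢'.SrcFiber (χ.base o) :=
  ⟨χ.toFun g.1, (χ.src_map g.1).trans (congrArg χ.base g.2)⟩

theorem fiberMap_fiberUnit (o : Q) : χ.fiberMap o (𝒢.fiberUnit o) = 𝒢'.fiberUnit (χ.base o) :=
  Subtype.ext (χ.map_unit o)

/-- The morphism of Lie algebroids induced by a morphism of Lie groupoids, on the fibre at `o`. -/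
noncomputable def algebroidMap (o : Q) : 𝒢.Algebroid o →L[ℝ] 𝒢'.Algebroid (χ.base o) :=
  (tangentCast (𝓡 (n' - q')) (χ.fiberMap_fiberUnit o)).comp
    (mfderiv (𝓡 (n - q)) (𝓡 (n' - q')) (χ.fiberMap o) (𝒢.fiberUnit o))

/-- The covectors `μ` at `x` and `μ'` at `χ x` are `χ^*`-related. -/
def CovectorRelated {x : G} (μ : TangentSpace (𝓡 n) x →L[ℝ] ℝ)
    (μ' : TangentSpace (𝓡 n') (χ.toFun x) →L[ℝ] ℝ) : Prop :=
  ∀ ξ : TangentSpace (𝓡 n) x, μ ξ = μ' (mfderiv (𝓡 n) (𝓡 n') χ.toFun x ξ)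

/-- The elements `z` and `z'` of the dual algebroids are `A^*χ`-related: `z'` lies over the image of the base point of
`z`, and `z ξ = z' (Aχ ξ)` for all `ξ`. -/
def DualRelated (z : 𝒢.DualAlgebroid) (z' : 𝒢'.DualAlgebroid) : Prop :=
  ∃ w : 𝒢'.Algebroid (χ.base z.proj) →L[ℝ] ℝ, z' = ⟨χ.base z.proj, w⟩ ∧
    ∀ ξ : 𝒢.Algebroid z.proj, z.snd ξ = w (χ.algebroidMap z.proj ξ)

end LieGroupoidHom

section Restriction

variable {n q n' q' : ℕ} {G Q G' Q' : Type*}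
  [TopologicalSpace G] [ChartedSpace (EuclideanSpace ℝ (Fin n)) G] [IsManifold (𝓡 n) ∞ G]
  [TopologicalSpace Q] [ChartedSpace (EuclideanSpace ℝ (Fin q)) Q] [IsManifold (𝓡 q) ∞ Q]
  [TopologicalSpace G'] [ChartedSpace (EuclideanSpace ℝ (Fin n')) G'] [IsManifold (𝓡 n') ∞ G']
  [TopologicalSpace Q'] [ChartedSpace (EuclideanSpace ℝ (Fin q')) Q'] [IsManifold (𝓡 q') ∞ Q']
  {𝒢 : LieGroupoid n q G Q} {𝒢' : LieGroupoid n' q' G' Q'}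

/-- The restriction to composable pairs of a morphism of prolongations for which the composable pairs of `𝒢` are the
preimage of those of `𝒢'`. -/
noncomputable def LieGroupoidHom.restrictComposable
    (χ : LieGroupoidHom 𝒢.prolongation 𝒢'.prolongation)
    (h : range 𝒢.inclusion = χ.toFun ⁻¹' range 𝒢'.inclusion) (z : 𝒢.Composable) :
    𝒢'.Composable :=
  (show χ.toFun (𝒢.inclusion z) ∈ range 𝒢'.inclusion from h.subset (mem_range_self z)).choose

theorem LieGroupoidHom.inclusion_restrictComposable
    (χ : LieGroupoidHom 𝒢.prolongation 𝒢'.prolongation)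
    (h : range 𝒢.inclusion = χ.toFun ⁻¹' range 𝒢'.inclusion) (z : 𝒢.Composable) :
    𝒢'.inclusion (χ.restrictComposable h z) = χ.toFun (𝒢.inclusion z) :=
  (show χ.toFun (𝒢.inclusion z) ∈ range 𝒢'.inclusion from h.subset (mem_range_self z)).choose_spec

end Restriction

/-! Everything follows from the chain rule applied to two kinds of commuting square.

For the cotangent source and target, the Lagrangians play no role: the statements hold for any
morphism `χ` of Lie groupoids. Multiplicativity gives `χ (g h) = χ g · χ h`, so `χ` intertwines left
translation by `g` with left translation by `χ g`, the source fibres being related by the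
restriction of `χ`. Differentiating at the identity, the differential of `χ` sends the
left-invariant vector of `a` at `g` to the left-invariant vector of `Aχ a` at `χ g`
(`mfderiv_leftInvariantOn`). Since `χ` also preserves inverses (`map_inv`), the same holds for `h ↦
h⁻¹ g` and right-invariant vectors (`mfderiv_rightInvariantOn`). Pairing with `χ^*`-related
covectors gives the `A^*χ`-relations.

For the generated submanifolds, let `i`, `i'` be the inclusions of the composable pairs and `ρ` the
restriction of `χ` to them, so that `χ ∘ i = i' ∘ ρ` and `L = L' ∘ ρ`. If `μ'` lies over a point of
the image of `i'`, the preimage condition places `μ` over the image of `i`, and `i^* μ = i^* χ^* μ'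
= ρ^* i'^* μ' = ρ^* dL' = dL`.

The formal difficulty is that base points agree only propositionally: `tgt (χ g)` and `χ.base (tgt
g)`, or `g · unit` and `g`. Two devices absorb this. Differentials are compared as maps between
fixed model spaces (`modelDeriv`), and translations are indexed by an arbitrary object `o` together
with a proof that `o` is the relevant endpoint. -/

/-! ### The chain rule in model coordinates. -/

section ModelDeriv

variable {E₁ H₁ M₁ : Type*} [NormedAddCommGroup E₁] [NormedSpace ℝ E₁] [TopologicalSpace H₁]
  {I₁ : ModelWithCorners ℝ E₁ H₁} [TopologicalSpace M₁] [ChartedSpace H₁ M₁]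
  {E₂ H₂ M₂ : Type*} [NormedAddCommGroup E₂] [NormedSpace ℝ E₂] [TopologicalSpace H₂]
  {I₂ : ModelWithCorners ℝ E₂ H₂} [TopologicalSpace M₂] [ChartedSpace H₂ M₂]
  {E₃ H₃ M₃ : Type*} [NormedAddCommGroup E₃] [NormedSpace ℝ E₃] [TopologicalSpace H₃]
  {I₃ : ModelWithCorners ℝ E₃ H₃} [TopologicalSpace M₃] [ChartedSpace H₃ M₃]

/-- The chain rule, with a base point that is only propositionally equal to `f x`. -/
theorem modelDeriv_comp_apply {g : M₂ → M₃} {f : M₁ → M₂} (hg : ContMDiff I₂ I₃ ∞ g)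
    (hf : ContMDiff I₁ I₂ ∞ f) {x : M₁} {y : M₂} (hy : f x = y) (v : E₁) :
    modelDeriv I₁ I₃ (fun z => g (f z)) x v = modelDeriv I₂ I₃ g y (modelDeriv I₁ I₂ f x v) := by
  -- Neither side has a type depending on `y`, so the equation can be stated for a variable `y` and
  -- reduces here to the usual chain rule.
  subst hy
  have h := mfderiv_comp x (hg.mdifferentiableAt (x := f x) (by simp))
    (hf.mdifferentiableAt (x := x) (by simp))
  exact congrArg (fun D : E₁ →L[ℝ] E₃ => D v) h

end ModelDeriv

/-! ### Uniqueness of inverses in a groupoid. -/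

/-- Bracket `g h h⁻¹` in the two possible ways. A morphism is only required to preserve products,
and this uniqueness is what makes it preserve inverses. -/
theorem GroupoidOver.eq_inv_of_mul_eq_unit {G Q : Type*} (𝒢 : GroupoidOver G Q) {g h : G}
    (hgh : 𝒢.tgt g = 𝒢.src h) (h1 : 𝒢.mul ⟨(g, h), hgh⟩ = 𝒢.unit (𝒢.tgt h)) : g = 𝒢.inv h := by
  have h2 := 𝒢.mul_assoc g h (𝒢.inv h) hgh (𝒢.src_inv h).symm
  have h3 := 𝒢.unit_mul (𝒢.inv h)
  have h4 := 𝒢.mul_unit g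
  simp only [𝒢.src_inv] at h3
  simp only [hgh] at h4
  -- The left bracketing collapses to `h⁻¹` and the right one to `g`.
  simp only [h1, 𝒢.mul_inv, h3, h4] at h2
  exact h2.symm

namespace LieGroupoid

variable {n q : ℕ} {G Q : Type*} [TopologicalSpace G] [ChartedSpace (EuclideanSpace ℝ (Fin n)) G]
  [IsManifold (𝓡 n) ∞ G] [TopologicalSpace Q] [ChartedSpace (EuclideanSpace ℝ (Fin q)) Q]
  [IsManifold (𝓡 q) ∞ Q] (𝒢 : LieGroupoid n q G Q)

/-! #### Translations between source fibres -/

/-- Left translation `h ↦ g h` on the source fibre of an object `o` equal to the target of `g`. -/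
def leftTranslationOn (g : G) {o : Q} (ho : 𝒢.tgt g = o) (h : 𝒢.SrcFiber o) : G :=
  𝒢.mul ⟨(g, h.1), ho.trans h.2.symm⟩

/-- The map `h ↦ h⁻¹ g` on the source fibre of an object `o` equal to the source of `g`. -/
def rightTranslationInvOn (g : G) {o : Q} (ho : 𝒢.src g = o) (h : 𝒢.SrcFiber o) : G :=
  𝒢.mul ⟨(𝒢.inv h.1, g), (𝒢.tgt_inv _).trans (h.2.trans ho.symm)⟩

theorem leftTranslationOn_fiberUnit (g : G) {o : Q} (ho : 𝒢.tgt g = o) :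
    𝒢.leftTranslationOn g ho (𝒢.fiberUnit o) = g := by
  subst ho; exact 𝒢.mul_unit g

theorem rightTranslationInvOn_fiberUnit (g : G) {o : Q} (ho : 𝒢.src g = o) :
    𝒢.rightTranslationInvOn g ho (𝒢.fiberUnit o) = g := by
  subst ho; exact 𝒢.inv_unit_mul g

theorem contMDiff_srcFiber_coe (o : Q) :
    ContMDiff (𝓡 (n - q)) (𝓡 n) ∞ (Subtype.val : 𝒢.SrcFiber o → G) :=
  (𝒢.srcFiber_isSubmanifold o).contMDiff_coe

/-- Multiplication is smooth only as a map on the submanifold of composable pairs, so the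
translation is factored through `h ↦ (g, h)`, whose smoothness may be checked in `G × G`. -/
theorem contMDiff_leftTranslationOn (g : G) {o : Q} (ho : 𝒢.tgt g = o) :
    ContMDiff (𝓡 (n - q)) (𝓡 n) ∞ (𝒢.leftTranslationOn g ho) := by
  let f : 𝒢.SrcFiber o → 𝒢.Composable := fun h => ⟨(g, h.1), ho.trans h.2.symm⟩
  have hf : ContMDiff (𝓡 (n - q)) (𝓡 (n + n - q)) ∞ f :=
    𝒢.composable_isSubmanifold.contMDiff_of_coe (f := f)
      (contMDiff_const.prodMk (𝒢.contMDiff_srcFiber_coe o))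
  exact 𝒢.contMDiff_mul.comp hf

theorem contMDiff_rightTranslationInvOn (g : G) {o : Q} (ho : 𝒢.src g = o) :
    ContMDiff (𝓡 (n - q)) (𝓡 n) ∞ (𝒢.rightTranslationInvOn g ho) := by
  let f : 𝒢.SrcFiber o → 𝒢.Composable := fun h =>
    ⟨(𝒢.inv h.1, g), (𝒢.tgt_inv _).trans (h.2.trans ho.symm)⟩
  have hf : ContMDiff (𝓡 (n - q)) (𝓡 (n + n - q)) ∞ f :=
    𝒢.composable_isSubmanifold.contMDiff_of_coe (f := f)
      ((𝒢.contMDiff_inv.comp (𝒢.contMDiff_srcFiber_coe o)).prodMk contMDiff_const)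
  exact 𝒢.contMDiff_mul.comp hf

/-- The value at `g` of the left-invariant vector field of an element of the fibre of the Lie algebroid at an object
equal to the target of `g`. -/
noncomputable def leftInvariantOn (g : G) {o : Q} (ho : 𝒢.tgt g = o) :
    𝒢.Algebroid o →L[ℝ] TangentSpace (𝓡 n) g :=
  -- The derivative takes values at `g · unit o`, but every tangent space is by definition the model
  -- space, so its values can be read as vectors at `g` without a cast.
  modelDeriv (𝓡 (n - q)) (𝓡 n) (𝒢.leftTranslationOn g ho) (𝒢.fiberUnit o)

/-- The value at `g` of the right-invariant vector field of an element of the fibre of the Lie algebroid at an object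
equal to the source of `g`. -/
noncomputable def rightInvariantOn (g : G) {o : Q} (ho : 𝒢.src g = o) :
    𝒢.Algebroid o →L[ℝ] TangentSpace (𝓡 n) g :=
  -modelDeriv (𝓡 (n - q)) (𝓡 n) (𝒢.rightTranslationInvOn g ho) (𝒢.fiberUnit o)

/-- The cast in `leftInvariant` is the identity on the model space. -/
theorem leftInvariant_eq_leftInvariantOn (g : G) :
    𝒢.leftInvariant g = 𝒢.leftInvariantOn g rfl :=
  ContinuousLinearMap.ext fun _ => tangentCast_apply (𝓡 n) (𝒢.mul_unit g) _

theorem rightInvariant_eq_rightInvariantOn (g : G) :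
    𝒢.rightInvariant g = 𝒢.rightInvariantOn g rfl :=
  ContinuousLinearMap.ext fun _ =>
    congrArg Neg.neg (tangentCast_apply (𝓡 n) (𝒢.inv_unit_mul g) _)

/-- Moves the base point of the covector to any object equal to the source of `g`. For a morphism
`χ` it is applied at `χ x` with `o = χ.base (src x)`, the base point that `DualRelated` demands. -/
theorem cotangentSrc_eq {g : G} (μ : TangentSpace (𝓡 n) g →L[ℝ] ℝ) {o : Q} (ho : 𝒢.src g = o) :
    𝒢.cotangentSrc ⟨g, μ⟩ = ⟨o, μ.comp (𝒢.rightInvariantOn g ho)⟩ := by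
  subst ho
  rw [← rightInvariant_eq_rightInvariantOn]; rfl

theorem cotangentTgt_eq {g : G} (μ : TangentSpace (𝓡 n) g →L[ℝ] ℝ) {o : Q} (ho : 𝒢.tgt g = o) :
    𝒢.cotangentTgt ⟨g, μ⟩ = ⟨o, μ.comp (𝒢.leftInvariantOn g ho)⟩ := by
  subst ho
  rw [← leftInvariant_eq_leftInvariantOn]; rfl

/-! #### The inclusion of the composable pairs -/

/-- A composable pair is recovered from the first and third entries of its image. This also shows
that the pair selected by choice in `restrictComposable` is the only possible one. -/
theorem inclusion_injective : Function.Injective 𝒢.inclusion := fun _ _ h =>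
  Subtype.ext (Prod.ext (congrArg (fun x : 𝒢.Prolongation => x.1.1) h)
    (congrArg (fun x : 𝒢.Prolongation => x.1.2.2) h))

theorem contMDiff_inclusion :
    ContMDiff (𝓡 (n + n - q)) (𝓡 (n + (n + n) - (q + q))) ∞ 𝒢.inclusion := by
  have h := 𝒢.composable_isSubmanifold.contMDiff_coe
  exact 𝒢.prolongation_isSubmanifold.contMDiff_of_coe (f := 𝒢.inclusion)
    ((contMDiff_fst.comp h).prodMk ((contMDiff_fst.comp h).prodMk (contMDiff_snd.comp h)))

/-- Eliminates the equality in the total space of the cotangent bundle, leaving an equation of base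
points and an identity between `modelDeriv`s to which the chain rule applies directly. -/
theorem mk_mem_generatedSubmanifold_iff (L : 𝒢.Composable → ℝ) (x : 𝒢.Prolongation)
    (μ : TangentSpace (𝓡 (n + (n + n) - (q + q))) x →L[ℝ] ℝ) :
    ⟨x, μ⟩ ∈ 𝒢.generatedSubmanifold L ↔ ∃ z, 𝒢.inclusion z = x ∧
      ∀ v : EuclideanSpace ℝ (Fin (n + n - q)),
        μ (modelDeriv (𝓡 (n + n - q)) (𝓡 (n + (n + n) - (q + q))) 𝒢.inclusion z v) =
          modelDeriv (𝓡 (n + n - q)) 𝓘(ℝ, ℝ) L z v := by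
  constructor
  · rintro ⟨z, ν, h, hν⟩
    cases h
    exact ⟨z, rfl, hν⟩
  · rintro ⟨z, rfl, h⟩
    exact ⟨z, μ, rfl, h⟩

end LieGroupoid

/-! ### Morphisms and invariant vector fields. -/

namespace LieGroupoidHom

variable {n q n' q' : ℕ} {G Q G' Q' : Type*}
  [TopologicalSpace G] [ChartedSpace (EuclideanSpace ℝ (Fin n)) G] [IsManifold (𝓡 n) ∞ G]
  [TopologicalSpace Q] [ChartedSpace (EuclideanSpace ℝ (Fin q)) Q] [IsManifold (𝓡 q) ∞ Q]
  [TopologicalSpace G'] [ChartedSpace (EuclideanSpace ℝ (Fin n')) G'] [IsManifold (𝓡 n') ∞ G']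
  [TopologicalSpace Q'] [ChartedSpace (EuclideanSpace ℝ (Fin q')) Q'] [IsManifold (𝓡 q') ∞ Q']
  {𝒢 : LieGroupoid n q G Q} {𝒢' : LieGroupoid n' q' G' Q'}

section

variable (χ : LieGroupoidHom 𝒢 𝒢')

/-- A source fibre is a submanifold, so smoothness can be tested after including it in `G'`. -/
theorem contMDiff_fiberMap (o : Q) :
    ContMDiff (𝓡 (n - q)) (𝓡 (n' - q')) ∞ (χ.fiberMap o) :=
  (𝒢'.srcFiber_isSubmanifold _).contMDiff_of_coe (f := χ.fiberMap o)
    (χ.contMDiff_toFun.comp (𝒢.contMDiff_srcFiber_coe o))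

theorem algebroidMap_apply (o : Q) (ξ : 𝒢.Algebroid o) :
    @Eq (EuclideanSpace ℝ (Fin (n' - q'))) (χ.algebroidMap o ξ)
      (modelDeriv (𝓡 (n - q)) (𝓡 (n' - q')) (χ.fiberMap o) (𝒢.fiberUnit o) ξ) :=
  tangentCast_apply (𝓡 (n' - q')) (χ.fiberMap_fiberUnit o) _

/-- Applying `χ` to `g⁻¹ g` shows that `χ g⁻¹` is a left inverse of `χ g`. -/
theorem map_inv (g : G) : χ.toFun (𝒢.inv g) = 𝒢'.inv (χ.toFun g) := by
  have h := χ.map_mul ⟨(𝒢.inv g, g), 𝒢.tgt_inv g⟩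
  -- The last rewrite places the identity at `tgt (χ g)`, as uniqueness of inverses requires.
  rw [𝒢.inv_mul, χ.map_unit, ← χ.tgt_map] at h
  exact 𝒢'.eq_inv_of_mul_eq_unit _ h.symm

/-- The commuting square whose derivative at the identity gives the compatibility of `χ` with
left-invariant vectors. `χ.fiberMap` lands in the fibre over `χ.base (tgt g)`, hence the explicit
proof `χ.tgt_map g`. -/
theorem map_leftTranslationOn (g : G) (h : 𝒢.SrcFiber (𝒢.tgt g)) :
    χ.toFun (𝒢.leftTranslationOn g rfl h) =
      𝒢'.leftTranslationOn (χ.toFun g) (χ.tgt_map g) (χ.fiberMap _ h) :=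
  χ.map_mul _

theorem map_rightTranslationInvOn (g : G) (h : 𝒢.SrcFiber (𝒢.src g)) :
    χ.toFun (𝒢.rightTranslationInvOn g rfl h) =
      𝒢'.rightTranslationInvOn (χ.toFun g) (χ.src_map g) (χ.fiberMap _ h) := by
  refine (χ.map_mul _).trans (congrArg 𝒢'.mul (Subtype.ext (Prod.ext ?_ rfl)))
  exact χ.map_inv h.1

/-- The differential of a morphism maps left-invariant vector fields to left-invariant vector fields. -/
theorem mfderiv_leftInvariantOn (g : G) (ξ : 𝒢.Algebroid (𝒢.tgt g)) :
    mfderiv (𝓡 n) (𝓡 n') χ.toFun g (𝒢.leftInvariantOn g rfl ξ) =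
      𝒢'.leftInvariantOn (χ.toFun g) (χ.tgt_map g) (χ.algebroidMap _ ξ) := by
  have h1 := modelDeriv_comp_apply χ.contMDiff_toFun (𝒢.contMDiff_leftTranslationOn g rfl)
    (𝒢.leftTranslationOn_fiberUnit g rfl) ξ
  have h2 := modelDeriv_comp_apply
    (𝒢'.contMDiff_leftTranslationOn (χ.toFun g) (χ.tgt_map g))
    (χ.contMDiff_fiberMap (𝒢.tgt g)) (χ.fiberMap_fiberUnit _) ξ
  -- `h1` and `h2` differentiate the two paths around the square. Rewriting backwards turns the
  -- composite in `h2` into the one in `h1`, and the derivative of `χ.fiberMap` into `Aχ`.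
  simp only [← map_leftTranslationOn, ← algebroidMap_apply] at h2
  exact h1.symm.trans h2

/-- The differential of a morphism maps right-invariant vector fields to right-invariant vector fields. -/
theorem mfderiv_rightInvariantOn (g : G) (ξ : 𝒢.Algebroid (𝒢.src g)) :
    mfderiv (𝓡 n) (𝓡 n') χ.toFun g (𝒢.rightInvariantOn g rfl ξ) =
      𝒢'.rightInvariantOn (χ.toFun g) (χ.src_map g) (χ.algebroidMap _ ξ) := by
  have h1 := modelDeriv_comp_apply χ.contMDiff_toFun (𝒢.contMDiff_rightTranslationInvOn g rfl)
    (𝒢.rightTranslationInvOn_fiberUnit g rfl) ξ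
  have h2 := modelDeriv_comp_apply
    (𝒢'.contMDiff_rightTranslationInvOn (χ.toFun g) (χ.src_map g))
    (χ.contMDiff_fiberMap (𝒢.src g)) (χ.fiberMap_fiberUnit _) ξ
  simp only [← map_rightTranslationInvOn, ← algebroidMap_apply] at h2
  -- The minus sign in the definition of right-invariant vectors passes through the differential of
  -- `χ` by linearity.
  exact (map_neg (modelDeriv (𝓡 n) (𝓡 n') χ.toFun g) _).trans
    (congrArg Neg.neg (h1.symm.trans h2))

/-! ### Related covectors have related sources and targets. -/

variable {χ}

theorem CovectorRelated.dualRelated_cotangentSrc {x : G} {μ : TangentSpace (𝓡 n) x →L[ℝ] ℝ}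
    {μ' : TangentSpace (𝓡 n') (χ.toFun x) →L[ℝ] ℝ} (h : χ.CovectorRelated μ μ') :
    χ.DualRelated (𝒢.cotangentSrc ⟨x, μ⟩) (𝒢'.cotangentSrc ⟨χ.toFun x, μ'⟩) := by
  rw [𝒢.cotangentSrc_eq μ rfl]
  -- The witness is `μ'` composed with the right-invariant extension at `χ x`, taken over `χ.base
  -- (src x)`. Both sides then become `μ'` evaluated on vectors that the intertwining of
  -- right-invariant vectors identifies.
  refine ⟨_, 𝒢'.cotangentSrc_eq μ' (χ.src_map x), fun ξ => (h _).trans ?_⟩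
  exact congrArg μ' (χ.mfderiv_rightInvariantOn x ξ)

theorem CovectorRelated.dualRelated_cotangentTgt {x : G} {μ : TangentSpace (𝓡 n) x →L[ℝ] ℝ}
    {μ' : TangentSpace (𝓡 n') (χ.toFun x) →L[ℝ] ℝ} (h : χ.CovectorRelated μ μ') :
    χ.DualRelated (𝒢.cotangentTgt ⟨x, μ⟩) (𝒢'.cotangentTgt ⟨χ.toFun x, μ'⟩) := by
  rw [𝒢.cotangentTgt_eq μ rfl]
  refine ⟨_, 𝒢'.cotangentTgt_eq μ' (χ.tgt_map x), fun ξ => (h _).trans ?_⟩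
  exact congrArg μ' (χ.mfderiv_leftInvariantOn x ξ)

end

/-! ### Restriction to composable pairs and the generated submanifolds. -/

variable (χ : LieGroupoidHom 𝒢.prolongation 𝒢'.prolongation)
  (h : range 𝒢.inclusion = χ.toFun ⁻¹' range 𝒢'.inclusion)

/-- Although defined by choice, the restriction must consist of the first and third entries of `χ (i
z)`, because `i' (g, h) = (g, g, h)`. These depend smoothly on `z`. -/
theorem contMDiff_restrictComposable :
    ContMDiff (𝓡 (n + n - q)) (𝓡 (n' + n' - q')) ∞ (χ.restrictComposable h) := by
  have h1 := χ.contMDiff_toFun.comp 𝒢.contMDiff_inclusion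
  have h2 := (𝒢'.contMDiff_prolongation_fst.comp h1).prodMk
    (𝒢'.contMDiff_prolongation_snd.comp h1)
  refine 𝒢'.composable_isSubmanifold.contMDiff_of_coe (f := χ.restrictComposable h) ?_
  refine h2.congr fun z => ?_
  change _ = ((χ.toFun (𝒢.inclusion z)).1.1, (χ.toFun (𝒢.inclusion z)).1.2.2)
  rw [← χ.inclusion_restrictComposable h z]
  rfl

variable {χ} in
-- Pull the condition `i'^* μ' = dL'` back along the restriction `ρ` of `χ`, using `i' ∘ ρ = χ ∘ i`
-- on the left and `L' ∘ ρ = L` on the right.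
theorem CovectorRelated.mem_generatedSubmanifold {L : 𝒢.Composable → ℝ} {L' : 𝒢'.Composable → ℝ}
    (hL' : ContMDiff (𝓡 (n' + n' - q')) 𝓘(ℝ, ℝ) ∞ L') (hLL' : L = L' ∘ χ.restrictComposable h)
    {x : 𝒢.Prolongation} {μ : TangentSpace (𝓡 (n + (n + n) - (q + q))) x →L[ℝ] ℝ}
    {μ' : TangentSpace (𝓡 (n' + (n' + n') - (q' + q'))) (χ.toFun x) →L[ℝ] ℝ}
    (hμ : χ.CovectorRelated μ μ') (hμ' : ⟨χ.toFun x, μ'⟩ ∈ 𝒢'.generatedSubmanifold L') :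
    ⟨x, μ⟩ ∈ 𝒢.generatedSubmanifold L := by
  rw [LieGroupoid.mk_mem_generatedSubmanifold_iff] at hμ' ⊢
  obtain ⟨z', hz', hv'⟩ := hμ'
  -- Since `χ x` is in the image of `i'`, the inclusion of the preimage in the image of `i` provides
  -- the composable pair under `x`.
  obtain ⟨z, rfl⟩ : x ∈ range 𝒢.inclusion := h.superset ⟨z', hz'⟩
  have hz : χ.restrictComposable h z = z' :=
    𝒢'.inclusion_injective ((χ.inclusion_restrictComposable h z).trans hz'.symm)
  refine ⟨z, rfl, fun v => (hμ _).trans ?_⟩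
  have h1 := modelDeriv_comp_apply χ.contMDiff_toFun 𝒢.contMDiff_inclusion (x := z) rfl v
  -- The proof `hz` makes the outer derivatives in `h2` and `h3` live at `z'`, the point where the
  -- condition on `μ'` is given.
  have h2 := modelDeriv_comp_apply 𝒢'.contMDiff_inclusion (χ.contMDiff_restrictComposable h) hz v
  have h3 := modelDeriv_comp_apply hL' (χ.contMDiff_restrictComposable h) hz v
  -- Replaces `i' ∘ ρ` by `χ ∘ i`, so that `h1` and `h2` compute the same derivative.
  simp only [χ.inclusion_restrictComposable h] at h2
  rw [hLL']
  exact (congrArg μ' (h1.symm.trans h2)).trans ((hv' _).trans h3.symm)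

end LieGroupoidHom

theorem mainTheorem5 {n q n' q' : ℕ} {G Q G' Q' : Type*}
    [TopologicalSpace G] [ChartedSpace (EuclideanSpace ℝ (Fin n)) G] [IsManifold (𝓡 n) ∞ G]
    [TopologicalSpace Q] [ChartedSpace (EuclideanSpace ℝ (Fin q)) Q] [IsManifold (𝓡 q) ∞ Q]
    [TopologicalSpace G'] [ChartedSpace (EuclideanSpace ℝ (Fin n')) G'] [IsManifold (𝓡 n') ∞ G']
    [TopologicalSpace Q'] [ChartedSpace (EuclideanSpace ℝ (Fin q')) Q'] [IsManifold (𝓡 q') ∞ Q']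
    (𝒢 : LieGroupoid n q G Q) (𝒢' : LieGroupoid n' q' G' Q')
    (L : 𝒢.Composable → ℝ) (hL : ContMDiff (𝓡 (n + n - q)) 𝓘(ℝ, ℝ) ∞ L)
    (L' : 𝒢'.Composable → ℝ) (hL' : ContMDiff (𝓡 (n' + n' - q')) 𝓘(ℝ, ℝ) ∞ L')
    (χ : LieGroupoidHom 𝒢.prolongation 𝒢'.prolongation)
    (hχ : range 𝒢.inclusion = χ.toFun ⁻¹' range 𝒢'.inclusion)
    (hLL' : L = L' ∘ χ.restrictComposable hχ)
    (x : 𝒢.Prolongation)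
    (μ : TangentSpace (𝓡 (n + (n + n) - (q + q))) x →L[ℝ] ℝ)
    (μ' : TangentSpace (𝓡 (n' + (n' + n') - (q' + q'))) (χ.toFun x) →L[ℝ] ℝ)
    (hμ : χ.CovectorRelated μ μ') :
    ((⟨χ.toFun x, μ'⟩ ∈ 𝒢'.generatedSubmanifold L') → ⟨x, μ⟩ ∈ 𝒢.generatedSubmanifold L) ∧
      χ.DualRelated (𝒢.prolongation.cotangentSrc ⟨x, μ⟩)
        (𝒢'.prolongation.cotangentSrc ⟨χ.toFun x, μ'⟩) ∧
      χ.DualRelated (𝒢.prolongation.cotangentTgt ⟨x, μ⟩)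
        (𝒢'.prolongation.cotangentTgt ⟨χ.toFun x, μ'⟩) := by
  -- The last two components are the general statements about a morphism of Lie groupoids, taken for
  -- the two prolongations.
  exact ⟨hμ.mem_generatedSubmanifold hχ hL' hLL', hμ.dualRelated_cotangentSrc,
    hμ.dualRelated_cotangentTgt⟩
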